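/- Let $\Omega\subset\mathbb R^N$ ($N\ge 2$) be a bounded open set with Lipschitz boundary and let $T>0$. For every $f\in L^1(0,T;L^2(\Omega))$ and every $u_0\in L^2(\Omega)$, the problem $$u'-\operatorname{div}\Big(\frac{Du}{|Du|}\Big)=f\ \text{ in }(0,T)\times\Omega,\qquad u=0\ \text{ on }(0,T)\times\partial\Omega,\qquad u(0)=u_0$$ has at most one solution: if $u_1,u_2$ are solutions, then $u_1(t)=u_2(t)$ a.e. in $\Omega$ for every $t\in[0,T]$. Here $X=BV(\Omega)\cap L^2(\Omega)$ with norm $\max\{\|v\|_{BV(\Omega)},\|v\|_{L^2(\Omega)}\}$, where $\|v\|_{BV(\Omega)}=\int_\Omega|Dv|+\int_{\partial\Omega}|v|\,d\mathcal H^{N-1}$. The space $L^1(0,T;X)^*$ is identified with the space of $*$-weakly measurable, essentially bounded maps $(0,T)\to X^*$. If $\xi=\theta+g$ with $\theta\in X^*$ and $g\in L^2(\Omega)$, we write $\langle\!\langle\xi,v\rangle\!\rangle=\langle\theta,v\rangle+\int_\Omega gv\,dx$ for $v\in X$. A function $u\in C([0,T];L^2(\Omega))\cap L^1(0,T;BV(\Omega))$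 with $u(0)=u_0$ is a *solution* if there exist: (i) a vector field $z\in L^\infty((0,T)\times\Omega;\mathbb R^N)$ with $\|z\|_\infty\le 1$, and an element of $L^1(0,T;X)^*$, again denoted by $\operatorname{div}z$, which extends the distributional (spatial) divergence of $z$ and is such that for a.e. $t\in(0,T)$: - there is $[z(t),\nu]\in L^\infty(\partial\Omega)$ with $\|[z(t),\nu]\|_\infty\le1$ and $\langle\operatorname{div}z(t),v\rangle+\int_\Omega z(t)\cdot\nabla v\,dx=\int_{\partial\Omega}v\,[z(t),\nu]\,d\mathcal H^{N-1}$ for all $v\in W^{1,1}(\Omega)\cap L^\infty(\Omega)$; - for every $v\in X$ the distribution $\langle (z(t),Dv),\omega\rangle=-\langle\operatorname{div}z(t),v\omega\rangle-\int_\Omega v\,z(t)\cdot\nabla\omega\,dx$, $\omega\in C_0^\infty(\Omega)$, is a finite Radon measure on $\Omega$, and $\langle\operatorname{div}z(t),v\rangle+\int_\Omega(z(t),Dv)=\int_{\partial\Omega}v\,[z(t),\nu]\,d\mathcal H^{N-1}$; (ii) $\xi\in L^1(0,T;X)^*+L^1(0,T;L^2(\Omega))$ which is the time derivative of $u$, that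 is, $$\int_0^T\langle\!\langle\xi(t),\Psi(t)\rangle\!\rangle\,dt=-\int_0^T\!\!\int_\Omega u(t)\,\Theta(t)\,dx\,dt$$ for every $\Psi\in L^1(0,T;BV(\Omega))\cap L^\infty(0,T;L^2(\Omega))$ with compact support in $(0,T)$ such that $\Psi(t)=\int_0^t\Theta(s)\,ds$ (Pettis integral in $BV(\Omega)$), where $\Theta\in L^1(0,T;L^2(\Omega))$ is weakly measurable into $BV(\Omega)$ with $\int_0^T\|\Theta(t)\|_{BV(\Omega)}dt<\infty$; and if, for a.e. $t\in(0,T)$, 1. $\langle\!\langle\xi(t),v\rangle\!\rangle=\langle\operatorname{div}z(t),v\rangle+\int_\Omega f(t)\,v\,dx$ for all $v\in X$; 2. $(z(t),Du(t))=|Du(t)|$ as measures in $\Omega$; 3. $[z(t),\nu]\in\operatorname{sign}(-u(t))$ $\mathcal H^{N-1}$-a.e. on $\partial\Omega$, where $\operatorname{sign}(s)=\{s/|s|\}$ for $s\neq0$ and $\operatorname{sign}(0)=[-1,1]$; 4. $\langle\!\langle\xi(t),u(t)\rangle\!\rangle=\frac12\big(\int_\Omega u(t)^2\,dx\big)'$,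 where $'$ is the derivative in the sense of distributions on $(0,T)$ (in particular the left-hand side is locally integrable). -/

import Mathlib

open MeasureTheory Set Filter Topology
open scoped ContDiff MeasureTheory

noncomputable section

namespace TVFlow

/-- The Euclidean space `ℝ^N`. -/
abbrev Eu (N : ℕ) : Type := EuclideanSpace ℝ (Fin N)

/-- The space `L²(Ω)` (with respect to Lebesgue measure). -/
abbrev L2 {N : ℕ} (Ω : Set (Eu N)) : Type := Lp ℝ 2 (volume.restrict Ω)

/-- `φ ∈ C₀^∞(U)`: smooth, with compact support contained in `U`. -/
def IsTest {F : Type*} [NormedAddCommGroup F] [NormedSpace ℝ F] (U : Set F) (φ : F → ℝ) : Prop :=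
  ContDiff ℝ ∞ φ ∧ HasCompactSupport φ ∧ tsupport φ ⊆ U

/-- `Ω` has Lipschitz boundary: near every boundary point `p` there is a direction `n` such that
`Ω` is the region strictly below the graph, in direction `n`, of a Lipschitz function of the
component of the point orthogonal to `n`. -/
def HasLipschitzBoundary {N : ℕ} (Ω : Set (Eu N)) : Prop :=
  ∀ p ∈ frontier Ω, ∃ n : Eu N, ‖n‖ = 1 ∧ ∃ r : ℝ, 0 < r ∧ ∃ (K : NNReal) (g : Eu N → ℝ),
    LipschitzWith K g ∧
      ∀ x ∈ Metric.ball p r, (x ∈ Ω ↔ inner ℝ x n < g (x - (inner ℝ x n : ℝ) • n))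

/-! ### Functions of bounded variation -/

/-- The finite vector-valued Radon measure `μ` on `Ω` (extended by zero outside `Ω`) is the
distributional gradient `Dv` of `v` in `Ω`. -/
structure IsGradientMeasure {N : ℕ} (Ω : Set (Eu N)) (v : Eu N → ℝ)
    (μ : VectorMeasure (Eu N) (Eu N)) : Prop where
  finite : μ.variation univ < ⊤
  concentrated : μ.variation Ωᶜ = 0
  integral_eq : ∀ φ : Eu N → ℝ, IsTest Ω φ →
    ∫ x in Ω, v x • gradient φ x = - ∫ᵛ x, φ x ∂•μ

/-- `v ∈ BV(Ω)`. -/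
def MemBV {N : ℕ} (Ω : Set (Eu N)) (v : Eu N → ℝ) : Prop :=
  IntegrableOn v Ω ∧ ∃ μ, IsGradientMeasure Ω v μ

open Classical in
/-- The distributional gradient `Dv` of `v ∈ BV(Ω)`, as a vector measure. -/
def gradMeasure {N : ℕ} (Ω : Set (Eu N)) (v : Eu N → ℝ) : VectorMeasure (Eu N) (Eu N) :=
  if h : ∃ μ, IsGradientMeasure Ω v μ then h.choose else 0

/-- The total variation measure `|Dv|`. -/
def totalVar {N : ℕ} (Ω : Set (Eu N)) (v : Eu N → ℝ) : Measure (Eu N) :=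
  (gradMeasure Ω v).variation

/-- The surface measure `ℋ^{N-1}` on `∂Ω` (normalised as Euclidean surface area). -/
def surface {N : ℕ} (Ω : Set (Eu N)) : Measure (Eu N) :=
  (Measure.euclideanHausdorffMeasure (N - 1)).restrict (frontier Ω)

/-- `g ∈ L¹(∂Ω)` is the boundary trace of `v`: at almost every boundary point `x`, the mean of
`|v - g x|` over `B(x, r) ∩ Ω` tends to `0` as `r → 0`. -/
def IsTrace {N : ℕ} (Ω : Set (Eu N)) (v g : Eu N → ℝ) : Prop :=
  Integrable g (surface Ω) ∧
    ∀ᵐ x ∂(surface Ω),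
      Tendsto (fun r : ℝ => ⨍ y in Metric.ball x r ∩ Ω, |v y - g x|) (𝓝[>] 0) (𝓝 0)

open Classical in
/-- The boundary trace of `v ∈ BV(Ω)`, defined up to `ℋ^{N-1}`-null sets. -/
def trace {N : ℕ} (Ω : Set (Eu N)) (v : Eu N → ℝ) : Eu N → ℝ :=
  if h : ∃ g, IsTrace Ω v g then h.choose else 0

/-- The norm `‖v‖_{BV(Ω)} = ∫_Ω |Dv| + ∫_{∂Ω} |v| dℋ^{N-1}`. -/
def bvNorm {N : ℕ} (Ω : Set (Eu N)) (v : Eu N → ℝ) : ℝ :=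
  (totalVar Ω v).real Ω + ∫ x, |trace Ω v x| ∂(surface Ω)

theorem IsTest.integrableOn_smul_gradient {N : ℕ} {Ω : Set (Eu N)} {v φ : Eu N → ℝ}
    (hv : IntegrableOn v Ω) (hφ : IsTest Ω φ) :
    Integrable (fun x => v x • gradient φ x) (volume.restrict Ω) := by
  have hc : Continuous (gradient φ) := by
    unfold gradient
    exact (LinearIsometryEquiv.continuous _).comp (hφ.1.continuous_fderiv (by simp))
  have hcs : HasCompactSupport (gradient φ) := by
    have h := hφ.2.1.fderiv (𝕜 := ℝ)
    exact h.comp_left (g := (InnerProductSpace.toDual ℝ (Eu N)).symm) (map_zero _)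
  obtain ⟨C, hC⟩ := hcs.exists_bound_of_continuous hc
  exact hv.smul_bdd C hc.aestronglyMeasurable (Eventually.of_forall hC)

theorem IsTest.vm_integrable {N : ℕ} {Ω : Set (Eu N)} {φ : Eu N → ℝ} (hφ : IsTest Ω φ)
    {μ : VectorMeasure (Eu N) (Eu N)} (hμ : μ.variation univ < ⊤) : μ.Integrable φ := by
  have : IsFiniteMeasure μ.variation := ⟨hμ⟩
  exact hφ.1.continuous.integrable_of_hasCompactSupport hφ.2.1

theorem IsGradientMeasure.congr {N : ℕ} {Ω : Set (Eu N)} {v w : Eu N → ℝ}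
    {μ : VectorMeasure (Eu N) (Eu N)} (h : IsGradientMeasure Ω v μ)
    (hvw : w =ᵐ[volume.restrict Ω] v) : IsGradientMeasure Ω w μ := by
  refine ⟨h.finite, h.concentrated, fun φ hφ => ?_⟩
  rw [← h.integral_eq φ hφ]
  refine integral_congr_ae ?_
  filter_upwards [hvw] with x hx
  rw [hx]

/-- The space `BV(Ω) ∩ L²(Ω)`, as a subspace of `L²(Ω)`. -/
def BVL2 {N : ℕ} (Ω : Set (Eu N)) : Submodule ℝ (L2 Ω) where
  carrier := {v | MemBV Ω v}
  zero_mem' := by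
    have h0 : ((0 : L2 Ω) : Eu N → ℝ) =ᵐ[volume.restrict Ω] 0 := Lp.coeFn_zero ..
    refine ⟨(integrable_congr h0).2 (integrable_zero ..), 0, ?_⟩
    refine IsGradientMeasure.congr (v := 0) ⟨by simp, by simp, fun φ _ => by simp⟩ h0
  add_mem' := by
    rintro v w ⟨hv, μ, hμ⟩ ⟨hw, ν, hν⟩
    have ha := Lp.coeFn_add v w
    have hle := VectorMeasure.variation_add_le (μ := μ) (ν := ν)
    refine ⟨(integrable_congr ha).2 (hv.add hw), μ + ν, ?_⟩
    refine IsGradientMeasure.congr (v := ⇑v + ⇑w) ⟨?_, ?_, fun φ hφ => ?_⟩ ha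
    · exact (hle univ).trans_lt (ENNReal.add_lt_top.2 ⟨hμ.finite, hν.finite⟩)
    · refine le_antisymm ((hle _).trans ?_) bot_le
      simp [hμ.concentrated, hν.concentrated]
    · rw [VectorMeasure.integral_add_vectorMeasure (hφ.vm_integrable hμ.finite)
        (hφ.vm_integrable hν.finite), neg_add, ← hμ.integral_eq φ hφ, ← hν.integral_eq φ hφ,
        ← integral_add (hφ.integrableOn_smul_gradient hv) (hφ.integrableOn_smul_gradient hw)]
      refine integral_congr_ae (Eventually.of_forall fun x => ?_)
      simp only [Pi.add_apply, add_smul]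
  smul_mem' := by
    rintro c v ⟨hv, μ, hμ⟩
    have ha := Lp.coeFn_smul c v
    refine ⟨(integrable_congr ha).2 (hv.smul c), c • μ, ?_⟩
    refine IsGradientMeasure.congr (v := c • ⇑v) ⟨?_, ?_, fun φ hφ => ?_⟩ ha
    · rw [VectorMeasure.variation_smul]
      have := hμ.finite
      exact ENNReal.mul_lt_top ENNReal.coe_lt_top this
    · rw [VectorMeasure.variation_smul]
      simp [hμ.concentrated]
    · rw [VectorMeasure.integral_smul_vectorMeasure, ← smul_neg, ← hμ.integral_eq φ hφ,
        ← integral_smul]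
      refine integral_congr_ae (Eventually.of_forall fun x => ?_)
      simp only [Pi.smul_apply, smul_eq_mul, mul_smul]

/-- The norm `max {‖v‖_{BV(Ω)}, ‖v‖_{L²(Ω)}}` of `BV(Ω) ∩ L²(Ω)`. -/
def bvl2Norm {N : ℕ} {Ω : Set (Eu N)} (v : BVL2 Ω) : ℝ :=
  max (bvNorm Ω (v : L2 Ω)) ‖(v : L2 Ω)‖

open Classical in
/-- The value `⟨ζ, v⟩_Ω` of a functional `ζ` on `BV(Ω) ∩ L²(Ω)` at a function `v` which represents
an element of this space (and `0` for all other functions `v`). -/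
def pair {N : ℕ} {Ω : Set (Eu N)} (ζ : BVL2 Ω →ₗ[ℝ] ℝ) (v : Eu N → ℝ) : ℝ :=
  if h : ∃ w : BVL2 Ω, ((w : L2 Ω) : Eu N → ℝ) =ᵐ[volume.restrict Ω] v then ζ h.choose else 0

/-- `ζ ∈ L¹(0,T; BV(Ω) ∩ L²(Ω))^*`, this dual being identified with
`L^∞_{w*}(0,T; (BV(Ω) ∩ L²(Ω))^*)`. -/
def MemDual {N : ℕ} (Ω : Set (Eu N)) (T : ℝ) (ζ : ℝ → BVL2 Ω →ₗ[ℝ] ℝ) : Prop :=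
  (∀ v, AEMeasurable (fun t => ζ t v) (volume.restrict (Ioo 0 T))) ∧
    ∃ C : ℝ, ∀ᵐ t ∂(volume.restrict (Ioo 0 T)), ∀ v, |ζ t v| ≤ C * bvl2Norm v

/-- `u ∈ L¹(0,T; BV(Ω))`, for a function `u` with values in `L²(Ω)`: it has values in `BV(Ω)` at
almost every time, and its `BV`-norm is integrable. -/
def MemL1BV {N : ℕ} (Ω : Set (Eu N)) (T : ℝ) (u : ℝ → L2 Ω) : Prop :=
  AEStronglyMeasurable u (volume.restrict (Ioo 0 T)) ∧
    (∀ᵐ t ∂(volume.restrict (Ioo 0 T)), u t ∈ BVL2 Ω) ∧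
      IntegrableOn (fun t => bvNorm Ω (u t)) (Ioo 0 T)

/-! ### The time derivative -/

/-- The restriction to `BV(Ω) ∩ L²(Ω)` of a continuous functional on `BV(Ω)` (by the Hahn-Banach
theorem, every linear functional that is bounded for the `BV`-norm is such a restriction). -/
def IsBVFunctional {N : ℕ} {Ω : Set (Eu N)} (ℓ : BVL2 Ω →ₗ[ℝ] ℝ) : Prop :=
  ∃ C : ℝ, ∀ v : BVL2 Ω, |ℓ v| ≤ C * bvNorm Ω (v : L2 Ω)

/-- `Θ ∈ L¹_w(0,T; BV(Ω)) ∩ L¹(0,T; L²(Ω))`. -/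
structure MemWeakL1BV {N : ℕ} (Ω : Set (Eu N)) (T : ℝ) (Θ : ℝ → BVL2 Ω) : Prop where
  weakly_measurable : ∀ ℓ : BVL2 Ω →ₗ[ℝ] ℝ, IsBVFunctional ℓ →
    AEMeasurable (fun t => ℓ (Θ t)) (volume.restrict (Ioo 0 T))
  integrable_bvNorm : IntegrableOn (fun t => bvNorm Ω (Θ t : L2 Ω)) (Ioo 0 T)
  integrable_L2 : IntegrableOn (fun t => (Θ t : L2 Ω)) (Ioo 0 T)

/-- `w` is the Pettis integral in `BV(Ω)` of `Θ` over the set `S`. -/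
def IsPettisIntegral {N : ℕ} {Ω : Set (Eu N)} (Θ : ℝ → BVL2 Ω) (S : Set ℝ) (w : BVL2 Ω) : Prop :=
  ∀ ℓ : BVL2 Ω →ₗ[ℝ] ℝ, IsBVFunctional ℓ →
    IntegrableOn (fun s => ℓ (Θ s)) S ∧ ℓ w = ∫ s in S, ℓ (Θ s)

/-- `Ψ ∈ L¹(0,T; BV(Ω)) ∩ L^∞(0,T; L²(Ω))` has compact support in time and admits the weak
derivative `Θ ∈ L¹_w(0,T; BV(Ω)) ∩ L¹(0,T; L²(Ω))`, that is `Ψ(t) = ∫₀ᵗ Θ(s) ds` as a Pettis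
integral. -/
structure IsTimeTest {N : ℕ} (Ω : Set (Eu N)) (T : ℝ) (Ψ Θ : ℝ → BVL2 Ω) : Prop where
  memL1BV : MemL1BV Ω T (fun t => (Ψ t : L2 Ω))
  memLinfty : MemLp (fun t => (Ψ t : L2 Ω)) ⊤ (volume.restrict (Ioo 0 T))
  compact_support : ∃ a b : ℝ, 0 < a ∧ b < T ∧ ∀ t ∈ Ioo 0 T, t ∉ Icc a b → Ψ t = 0
  memWeak : MemWeakL1BV Ω T Θ
  pettis_integrable : ∀ S ⊆ Ioo 0 T, MeasurableSet S → ∃ w, IsPettisIntegral Θ S w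
  eq_integral : ∀ t ∈ Ioo 0 T, IsPettisIntegral Θ (Ioo 0 t) (Ψ t)

/-- The value `⟪ξ, v⟫_Ω = ⟨θ, v⟩_Ω + ∫_Ω g v` of `ξ = θ + g`, for `θ` in the dual of
`BV(Ω) ∩ L²(Ω)` and `g ∈ L²(Ω)`. -/
def pairSum {N : ℕ} {Ω : Set (Eu N)} (θ : BVL2 Ω →ₗ[ℝ] ℝ) (g : L2 Ω) (v : Eu N → ℝ) : ℝ :=
  pair θ v + ∫ x in Ω, g x * v x

/-- `ξ = θ + g ∈ L¹(0,T; BV(Ω) ∩ L²(Ω))^* + L¹(0,T; L²(Ω))` is the time derivative of `u`. -/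
structure IsTimeDerivative {N : ℕ} (Ω : Set (Eu N)) (T : ℝ) (u : ℝ → L2 Ω)
    (θ : ℝ → BVL2 Ω →ₗ[ℝ] ℝ) (g : ℝ → L2 Ω) : Prop where
  memDual : MemDual Ω T θ
  integrable : IntegrableOn g (Ioo 0 T)
  integral_eq : ∀ Ψ Θ : ℝ → BVL2 Ω, IsTimeTest Ω T Ψ Θ →
    ∫ t in Ioo 0 T, pairSum (θ t) (g t) (Ψ t : L2 Ω)
      = - ∫ t in Ioo 0 T, ∫ x in Ω, (u t) x * (Θ t : L2 Ω) x

/-! ### Anzellotti pairing, weak normal trace and Green's formula -/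

/-- The functional `ζ` extends the distributional divergence of the vector field `z` in `Ω`. -/
def ExtendsDiv {N : ℕ} {Ω : Set (Eu N)} (z : Eu N → Eu N) (ζ : BVL2 Ω →ₗ[ℝ] ℝ) : Prop :=
  ∀ ψ : Eu N → ℝ, IsTest Ω ψ → pair ζ ψ = - ∫ x in Ω, inner ℝ (z x) (gradient ψ x)

/-- The pairing `(z, Dv)`, a distribution in `Ω`; here `ζ` is the extended divergence of `z`. -/
def pairing {N : ℕ} {Ω : Set (Eu N)} (z : Eu N → Eu N) (ζ : BVL2 Ω →ₗ[ℝ] ℝ) (v : BVL2 Ω)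
    (ψ : Eu N → ℝ) : ℝ :=
  - pair ζ (fun x => (v : L2 Ω) x * ψ x)
    - ∫ x in Ω, (v : L2 Ω) x * inner ℝ (z x) (gradient ψ x)

/-- The distribution `(z, Dv)` is the finite (signed) Radon measure `μ` on `Ω`. -/
def IsPairingMeasure {N : ℕ} {Ω : Set (Eu N)} (z : Eu N → Eu N) (ζ : BVL2 Ω →ₗ[ℝ] ℝ)
    (v : BVL2 Ω) (μ : SignedMeasure (Eu N)) : Prop :=
  μ.variation univ < ⊤ ∧ μ.variation Ωᶜ = 0 ∧
    ∀ ψ : Eu N → ℝ, IsTest Ω ψ → pairing z ζ v ψ = ∫ᵛ x, ψ x ∂•μ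

/-- `G ∈ L¹(Ω; ℝ^N)` is the weak gradient of `v`, so that `v ∈ W^{1,1}(Ω)`. -/
def IsWeakGradient {N : ℕ} (Ω : Set (Eu N)) (v : Eu N → ℝ) (G : Eu N → Eu N) : Prop :=
  IntegrableOn v Ω ∧ IntegrableOn G Ω ∧
    ∀ φ : Eu N → ℝ, IsTest Ω φ → ∫ x in Ω, v x • gradient φ x = - ∫ x in Ω, φ x • G x

/-- `γ ∈ L^∞(∂Ω)` is the weak trace `[z, ν]` of the normal component of `z` (whose extended
divergence is `ζ`): it represents the functional `v ↦ ⟨div z, v⟩_Ω + ∫_Ω z · ∇v` on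
`W^{1,1}(Ω) ∩ L^∞(Ω)` through the boundary values of `v`. -/
def IsWeakNormalTrace {N : ℕ} {Ω : Set (Eu N)} (z : Eu N → Eu N) (ζ : BVL2 Ω →ₗ[ℝ] ℝ)
    (γ : Eu N → ℝ) : Prop :=
  MemLp γ ⊤ (surface Ω) ∧
    ∀ (v : Eu N → ℝ) (G : Eu N → Eu N), MemLp v ⊤ (volume.restrict Ω) → IsWeakGradient Ω v G →
      pair ζ v + ∫ x in Ω, inner ℝ (z x) (G x) = ∫ x, trace Ω v x * γ x ∂(surface Ω)

/-- For every `v ∈ BV(Ω) ∩ L²(Ω)`, `(z, Dv)` is a Radon measure and Green's formula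
`⟨div z, v⟩_Ω + ∫_Ω (z, Dv) = ∫_{∂Ω} v [z, ν] dℋ^{N-1}` holds. -/
def GreenFormula {N : ℕ} {Ω : Set (Eu N)} (z : Eu N → Eu N) (ζ : BVL2 Ω →ₗ[ℝ] ℝ)
    (γ : Eu N → ℝ) : Prop :=
  ∀ v : BVL2 Ω, ∃ μ : SignedMeasure (Eu N), IsPairingMeasure z ζ v μ ∧
    ζ v + μ Ω = ∫ x, trace Ω (v : L2 Ω) x * γ x ∂(surface Ω)

/-! ### Solutions -/

/-- The multivalued sign: `sign(s) = {s / |s|}` for `s ≠ 0`, and `sign(0) = [-1, 1]`. -/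
def multiSign (s : ℝ) : Set ℝ := {y | |y| ≤ 1 ∧ (0 < s → y = 1) ∧ (s < 0 → y = -1)}

/-- `G ∈ L¹_loc(0,T)` is the distributional derivative of `F` in `(0,T)`. -/
def IsDistribDeriv (T : ℝ) (F G : ℝ → ℝ) : Prop :=
  LocallyIntegrableOn G (Ioo 0 T) ∧
    ∀ η : ℝ → ℝ, IsTest (Ioo 0 T) η →
      ∫ t in Ioo 0 T, η t * G t = - ∫ t in Ioo 0 T, deriv η t * F t

/-- `u` is a solution of `u' - Δ₁ u = f` in `(0,T) × Ω`, `u = 0` on `(0,T) × ∂Ω`, `u(0) = u₀`, with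
vector field `z`, extended divergence `ζ = div z`, weak normal trace `γ(t) = [z(t), ν]` and time
derivative `ξ = θ + g`. -/
structure IsSolutionWith {N : ℕ} (Ω : Set (Eu N)) (T : ℝ) (f : ℝ → L2 Ω) (u₀ : L2 Ω)
    (u : ℝ → L2 Ω) (z : ℝ → Eu N → Eu N) (ζ : ℝ → BVL2 Ω →ₗ[ℝ] ℝ) (γ : ℝ → Eu N → ℝ)
    (θ : ℝ → BVL2 Ω →ₗ[ℝ] ℝ) (g : ℝ → L2 Ω) : Prop where
  continuousOn : ContinuousOn u (Icc 0 T)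
  memL1BV : MemL1BV Ω T u
  initial : u 0 = u₀
  z_measurable : AEStronglyMeasurable (fun p : ℝ × Eu N => z p.1 p.2)
    ((volume.restrict (Ioo 0 T)).prod (volume.restrict Ω))
  z_bound : ∀ᵐ p ∂((volume.restrict (Ioo 0 T)).prod (volume.restrict Ω)), ‖z p.1 p.2‖ ≤ 1
  div_memDual : MemDual Ω T ζ
  div_extends : ∀ᵐ t ∂(volume.restrict (Ioo 0 T)), ExtendsDiv (z t) (ζ t)
  normalTrace : ∀ᵐ t ∂(volume.restrict (Ioo 0 T)), IsWeakNormalTrace (z t) (ζ t) (γ t)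
  normalTrace_bound : ∀ᵐ t ∂(volume.restrict (Ioo 0 T)), ∀ᵐ x ∂(surface Ω), |γ t x| ≤ 1
  green : ∀ᵐ t ∂(volume.restrict (Ioo 0 T)), GreenFormula (z t) (ζ t) (γ t)
  timeDerivative : IsTimeDerivative Ω T u θ g
  /-- `ξ(t) = div z(t) + f(t)`, as functionals on `BV(Ω) ∩ L²(Ω)`. -/
  equation : ∀ᵐ t ∂(volume.restrict (Ioo 0 T)), ∀ v : BVL2 Ω,
    pairSum (θ t) (g t) (v : L2 Ω) = pairSum (ζ t) (f t) (v : L2 Ω)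
  /-- `(z(t), Du(t)) = |Du(t)|` as measures in `Ω`. -/
  pairing_eq : ∀ᵐ t ∂(volume.restrict (Ioo 0 T)), ∀ v : BVL2 Ω, (v : L2 Ω) = u t →
    ∀ ψ : Eu N → ℝ, IsTest Ω ψ → pairing (z t) (ζ t) v ψ = ∫ x, ψ x ∂(totalVar Ω (u t))
  /-- `[z(t), ν] ∈ sign(-u(t))` almost everywhere on `∂Ω`. -/
  boundary : ∀ᵐ t ∂(volume.restrict (Ioo 0 T)), ∀ᵐ x ∂(surface Ω),
    γ t x ∈ multiSign (- trace Ω (u t) x)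
  /-- `⟪ξ(t), u(t)⟫_Ω = ½ (∫_Ω u(t)²)'`. -/
  energy : IsDistribDeriv T (fun t => (1 / 2 : ℝ) * ∫ x in Ω, (u t x) ^ 2)
    (fun t => pairSum (θ t) (g t) (u t))

/-- `u` is a solution of the Dirichlet problem for `u' - Δ₁ u = f` with initial datum `u₀`. -/
def IsSolution {N : ℕ} (Ω : Set (Eu N)) (T : ℝ) (f : ℝ → L2 Ω) (u₀ : L2 Ω)
    (u : ℝ → L2 Ω) : Prop :=
  ∃ (z : ℝ → Eu N → Eu N) (ζ : ℝ → BVL2 Ω →ₗ[ℝ] ℝ) (γ : ℝ → Eu N → ℝ)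
    (θ : ℝ → BVL2 Ω →ₗ[ℝ] ℝ) (g : ℝ → L2 Ω), IsSolutionWith Ω T f u₀ u z ζ γ θ g

end TVFlow

end

/-!
Two solutions are compared through an evolution variational inequality, relative to fixed elements
of `BV(Ω) ∩ L²(Ω)`.

For a fixed `w ∈ BV(Ω) ∩ L²(Ω)` and a scalar test function `η` of time, `η(t) w` is an admissible
test function for the time derivative (`isTimeTest_smul`). Since `ξ = div z + f`, this shows that
the functional `w ↦ ∫ η ⟨div z(t), w⟩ dt` is `-∫ η' ⟨u, w⟩ dt - ∫ η ⟨f, w⟩ dt`, which is continuous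
for the norm of `L²(Ω)`. Hence, although `div z(t)` is only a functional on `BV(Ω) ∩ L²(Ω)`, the
time average `Z = ∫ η z dt`, for `η ≥ 0`, is a field with `|Z| ≤ ∫ η` and `div Z ∈ L²(Ω)`. For such
fields the bound `|⟨(Z, Dw), ψ⟩| ≤ ∫ η · |Dw|(Ω)`, `|ψ| ≤ 1`, follows by mollification of `wψ`
(`abs_pairing_le`). As `η ≥ 0` is arbitrary, `⟨(z(t), Dw), ψ⟩ ≤ |Dw|(Ω)` for almost every `t`
(`IsSolutionWith.pairing_le`). Cut-off functions `ψ` increasing to the indicator function of `Ω`,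
Green's formula and `|[z(t), ν]| ≤ 1` then give `⟨div z(t), w⟩ ≥ -‖w‖_{BV}` for almost every `t`
(`IsSolutionWith.neg_bvNorm_le`).

On the other hand `⟨div z(t), u(t)⟩ = -‖u(t)‖_{BV}`, from `(z(t), Du(t)) = |Du(t)|` and the boundary
condition (`IsSolutionWith.apply_self_eq`). With the energy identity this yields, in the sense of
distributions,
`(½ ‖u - w‖²)' ≤ ‖w‖_{BV} - ‖u‖_{BV} + ⟨f, u - w⟩` for every fixed `w ∈ BV(Ω) ∩ L²(Ω)`
(`IsSolutionWith.evi`).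

The exceptional set of times depends on `w`, but it disappears on integration in time; so the second
solution at a fixed time `s` may be inserted for `w`. Uniqueness is then Bénilan's argument for
integral solutions (`eq_of_evi`): the inequalities for `(u₁(t), u₂(s))` and `(u₂(t), u₁(s))` are
averaged over small squares `[τ, τ + h]²`, where the terms with `‖·‖_{BV}` cancel and the terms with
`f` vanish in the limit `h → 0`.
-/

noncomputable section

namespace TVFlow

/-! ### Uniqueness from evolution variational inequalities -/

section IntegralSolutions

variable {H : Type*} [NormedAddCommGroup H] [InnerProductSpace ℝ H] [CompleteSpace H]

omit [CompleteSpace H] in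
theorem half_norm_sub_sq_sub (x y z : H) :
    1 / 2 * ‖x - z‖ ^ 2 - 1 / 2 * ‖y - z‖ ^ 2
      = 1 / 2 * ‖x‖ ^ 2 - 1 / 2 * ‖y‖ ^ 2 - inner ℝ (x - y) z := by
  rw [norm_sub_sq_real, norm_sub_sq_real, inner_sub_left]
  ring

/-- The evolution variational inequality for `u` relative to `v s`, integrated over `s ∈ [a, b]` and
expanded. The first two terms on the right change sign when the roles of `u` and `v` are
exchanged. -/
theorem averaged_evi {u v f : ℝ → H} {φ φ' : ℝ → ℝ} {a b : ℝ} (hab : a ≤ b)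
    (hu : Continuous u) (hv : Continuous v) (hf : IntervalIntegrable f volume a b)
    (hφ : IntervalIntegrable φ volume a b) (hφ' : IntervalIntegrable φ' volume a b)
    (h : ∀ᵐ s ∂(volume.restrict (Ioc a b)),
      1 / 2 * ‖u b - v s‖ ^ 2 - 1 / 2 * ‖u a - v s‖ ^ 2
        ≤ ∫ t in a..b, (φ' s - φ t + inner ℝ (f t) (u t - v s))) :
    (b - a) * (1 / 2 * ‖u b‖ ^ 2 - 1 / 2 * ‖u a‖ ^ 2) - inner ℝ (u b - u a) (∫ s in a..b, v s)
      ≤ (b - a) * (∫ s in a..b, φ' s) - (b - a) * (∫ t in a..b, φ t)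
        + (b - a) * (∫ t in a..b, inner ℝ (f t) (u t))
        - inner ℝ (∫ t in a..b, f t) (∫ s in a..b, v s) := by
  have hvi : IntervalIntegrable v volume a b := hv.intervalIntegrable _ _
  have hfu : IntervalIntegrable (fun t => inner ℝ (f t) (u t)) volume a b := by
    obtain ⟨C, hC⟩ := isCompact_uIcc.exists_bound_of_continuousOn (hu.continuousOn (s := uIcc a b))
    rw [intervalIntegrable_iff] at hf ⊢
    refine (hf.norm.mul_const C).mono' (hf.aestronglyMeasurable.inner hu.aestronglyMeasurable) ?_
    refine (ae_restrict_iff' measurableSet_uIoc).2 (Eventually.of_forall fun t ht => ?_)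
    exact (norm_inner_le_norm _ _).trans
      (mul_le_mul_of_nonneg_left (hC t (uIoc_subset_uIcc ht)) (norm_nonneg _))
  have hconst : ∀ s, IntervalIntegrable (fun t => inner ℝ (f t) (v s)) volume a b := by
    intro s
    rw [intervalIntegrable_iff] at hf ⊢
    exact hf.inner_const (v s)
  have hinner : ∀ (x : H), (∫ s in a..b, inner ℝ x (v s)) = inner ℝ x (∫ s in a..b, v s) :=
    fun x => (innerSL ℝ x).intervalIntegral_comp_comm hvi
  have hinner' : ∀ s, (∫ t in a..b, inner ℝ (f t) (v s)) = inner ℝ (∫ t in a..b, f t) (v s) := by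
    intro s
    simp_rw [real_inner_comm (v s)]
    exact (innerSL ℝ (v s)).intervalIntegral_comp_comm hf
  have hci : ∀ x : H, IntervalIntegrable (fun s => inner ℝ x (v s)) volume a b := fun x =>
    (continuous_const.inner hv).intervalIntegrable _ _
  have key : ∫ s in a..b, (1 / 2 * ‖u b‖ ^ 2 - 1 / 2 * ‖u a‖ ^ 2 - inner ℝ (u b - u a) (v s))
      ≤ ∫ s in a..b, ((b - a) * φ' s + (- (∫ t in a..b, φ t) + (∫ t in a..b, inner ℝ (f t) (u t)))
        - inner ℝ (∫ t in a..b, f t) (v s)) := by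
    refine intervalIntegral.integral_mono_ae_restrict hab ?_ ?_ ?_
    · exact intervalIntegrable_const.sub (hci _)
    · exact ((hφ'.const_mul _).add intervalIntegrable_const).sub (hci _)
    · rw [← restrict_Ioc_eq_restrict_Icc]
      filter_upwards [h] with s hs
      rw [half_norm_sub_sq_sub] at hs
      refine hs.trans (le_of_eq ?_)
      have e : ∀ t, φ' s - φ t + inner ℝ (f t) (u t - v s)
          = (φ' s - φ t) + (inner ℝ (f t) (u t) - inner ℝ (f t) (v s)) := by
        intro t; rw [inner_sub_right]
      simp_rw [e]
      rw [intervalIntegral.integral_add (intervalIntegrable_const.sub hφ) (hfu.sub (hconst s)),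
        intervalIntegral.integral_sub intervalIntegrable_const hφ,
        intervalIntegral.integral_sub hfu (hconst s), hinner', intervalIntegral.integral_const,
        smul_eq_mul]
      ring
  rw [intervalIntegral.integral_sub intervalIntegrable_const (hci _),
    intervalIntegral.integral_sub ((hφ'.const_mul _).add intervalIntegrable_const) (hci _),
    intervalIntegral.integral_add (hφ'.const_mul _) intervalIntegrable_const, hinner, hinner,
    intervalIntegral.integral_const, intervalIntegral.integral_const,
    intervalIntegral.integral_const_mul, smul_eq_mul, smul_eq_mul] at key
  linarith

/-- If two continuous curves satisfy the evolution variational inequality relative to each other,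
then `∬ ½ ‖u t - v s‖²` over the moving square `[a, b]²` grows at a rate controlled by the
oscillation `ε` of the curves over `[a, b]`. The left-hand side is this rate of change, see
`hasDerivAt_windowDist`; the potentials `φ` and `φ'` cancel by symmetry. -/
theorem averaged_evi_add {u v f : ℝ → H} {φ φ' : ℝ → ℝ} {a b ε : ℝ} (hab : a ≤ b)
    (hu : Continuous u) (hv : Continuous v) (hf : IntervalIntegrable f volume a b)
    (hφ : IntervalIntegrable φ volume a b) (hφ' : IntervalIntegrable φ' volume a b)
    (huε : ∀ s ∈ Icc a b, ∀ t ∈ Icc a b, ‖u t - u s‖ ≤ ε)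
    (hvε : ∀ s ∈ Icc a b, ∀ t ∈ Icc a b, ‖v t - v s‖ ≤ ε)
    (h : ∀ᵐ s ∂(volume.restrict (Ioc a b)),
      1 / 2 * ‖u b - v s‖ ^ 2 - 1 / 2 * ‖u a - v s‖ ^ 2
        ≤ ∫ t in a..b, (φ' s - φ t + inner ℝ (f t) (u t - v s)))
    (h' : ∀ᵐ s ∂(volume.restrict (Ioc a b)),
      1 / 2 * ‖v b - u s‖ ^ 2 - 1 / 2 * ‖v a - u s‖ ^ 2
        ≤ ∫ t in a..b, (φ s - φ' t + inner ℝ (f t) (v t - u s))) :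
    (b - a) * (1 / 2 * ‖u b‖ ^ 2 - 1 / 2 * ‖u a‖ ^ 2)
      + (b - a) * (1 / 2 * ‖v b‖ ^ 2 - 1 / 2 * ‖v a‖ ^ 2)
      - (inner ℝ (u b - u a) (∫ s in a..b, v s) + inner ℝ (∫ s in a..b, u s) (v b - v a))
      ≤ 2 * (b - a) * ε * ∫ t in a..b, ‖f t‖ := by
  -- the average of `⟨f t, w t - w s⟩` over the square is small by the oscillation bound on `w`
  have bound : ∀ w : ℝ → H, Continuous w → (∀ s ∈ Icc a b, ∀ t ∈ Icc a b, ‖w t - w s‖ ≤ ε) →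
      (b - a) * (∫ t in a..b, inner ℝ (f t) (w t)) - inner ℝ (∫ t in a..b, f t) (∫ s in a..b, w s)
        ≤ (b - a) * ε * ∫ t in a..b, ‖f t‖ := by
    intro w hw hwε
    have hwi : IntervalIntegrable w volume a b := hw.intervalIntegrable _ _
    have e1 : inner ℝ (∫ t in a..b, f t) (∫ s in a..b, w s)
        = ∫ t in a..b, inner ℝ (f t) (∫ s in a..b, w s) := by
      have := (innerSL ℝ (∫ s in a..b, w s)).intervalIntegral_comp_comm hf
      simp only [innerSL_apply_apply] at this
      rw [real_inner_comm, ← this]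
      simp_rw [real_inner_comm]
    have hfw : IntervalIntegrable (fun t => inner ℝ (f t) (w t)) volume a b := by
      obtain ⟨C, hC⟩ :=
        isCompact_uIcc.exists_bound_of_continuousOn (hw.continuousOn (s := uIcc a b))
      rw [intervalIntegrable_iff] at hf ⊢
      refine (hf.norm.mul_const C).mono' (hf.aestronglyMeasurable.inner hw.aestronglyMeasurable) ?_
      refine (ae_restrict_iff' measurableSet_uIoc).2 (Eventually.of_forall fun t ht => ?_)
      exact (norm_inner_le_norm _ _).trans
        (mul_le_mul_of_nonneg_left (hC t (uIoc_subset_uIcc ht)) (norm_nonneg _))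
    have hfc : IntervalIntegrable (fun t => inner ℝ (f t) (∫ s in a..b, w s)) volume a b := by
      rw [intervalIntegrable_iff] at hf ⊢
      exact hf.inner_const _
    rw [e1, ← intervalIntegral.integral_const_mul, ← intervalIntegral.integral_sub
      (hfw.const_mul _) hfc, ← intervalIntegral.integral_const_mul]
    refine intervalIntegral.integral_mono_on hab ((hfw.const_mul _).sub hfc)
      (hf.norm.const_mul _) fun t ht => ?_
    have e2 : (b - a) * inner ℝ (f t) (w t) - inner ℝ (f t) (∫ s in a..b, w s)
        = inner ℝ (f t) (∫ s in a..b, (w t - w s)) := by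
      rw [intervalIntegral.integral_sub intervalIntegrable_const hwi,
        intervalIntegral.integral_const, inner_sub_right, inner_smul_right]
    have e3 : ‖∫ s in a..b, (w t - w s)‖ ≤ ε * |b - a| :=
      intervalIntegral.norm_integral_le_of_norm_le_const fun s hs => by
        rw [uIoc_of_le hab] at hs
        exact hwε s (Ioc_subset_Icc_self hs) t ht
    rw [abs_of_nonneg (sub_nonneg.2 hab)] at e3
    rw [e2]
    refine (real_inner_le_norm _ _).trans ?_
    calc ‖f t‖ * ‖∫ s in a..b, (w t - w s)‖ ≤ ‖f t‖ * (ε * (b - a)) := by gcongr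
      _ = _ := by ring
  have h1 := averaged_evi hab hu hv hf hφ hφ' h
  have h2 := averaged_evi hab hv hu hf hφ' hφ h'
  have h3 := bound u hu huε
  have h4 := bound v hv hvε
  rw [real_inner_comm (v b - v a)]
  linarith

theorem hasDerivAt_integral_window {E : Type*} [NormedAddCommGroup E] [NormedSpace ℝ E]
    [CompleteSpace E] {g : ℝ → E} (hg : Continuous g) (h τ : ℝ) :
    HasDerivAt (fun r => ∫ s in r..r + h, g s) (g (τ + h) - g τ) τ := by
  have hi : ∀ x y, IntervalIntegrable g volume x y := fun x y => hg.intervalIntegrable x y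
  have hd : ∀ x, HasDerivAt (fun r => ∫ s in (0 : ℝ)..r, g s) (g x) x := fun x =>
    intervalIntegral.integral_hasDerivAt_right (hi _ _)
      hg.stronglyMeasurable.stronglyMeasurableAtFilter hg.continuousAt
  have e : (fun r => ∫ s in r..r + h, g s)
      = fun r => (∫ s in (0 : ℝ)..(r + h), g s) - ∫ s in (0 : ℝ)..r, g s := by
    funext r
    rw [intervalIntegral.integral_interval_sub_left (hi _ _) (hi _ _)]
  rw [e]
  exact ((hd (τ + h)).comp_add_const τ h).sub (hd τ)

theorem tendsto_average_window {E : Type*} [NormedAddCommGroup E] [NormedSpace ℝ E]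
    [CompleteSpace E] {g : ℝ → E} (hg : Continuous g) (τ : ℝ) :
    Tendsto (fun h : ℝ => h⁻¹ • ∫ s in τ..τ + h, g s) (𝓝[>] 0) (𝓝 (g τ)) := by
  have hd : HasDerivAt (fun r => ∫ s in τ..r, g s) (g τ) τ :=
    intervalIntegral.integral_hasDerivAt_right (hg.intervalIntegrable _ _)
      hg.stronglyMeasurable.stronglyMeasurableAtFilter hg.continuousAt
  simpa using hd.tendsto_slope_zero_right

/-- The integral of `½ ‖u t - v s‖²` over `(t, s) ∈ [τ, τ + h]²`, written out by expanding the
square, so that only one-dimensional integrals occur. -/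
def windowDist (u v : ℝ → H) (h τ : ℝ) : ℝ :=
  h * (1 / 2 * ∫ s in τ..τ + h, ‖u s‖ ^ 2) + h * (1 / 2 * ∫ s in τ..τ + h, ‖v s‖ ^ 2)
    - inner ℝ (∫ s in τ..τ + h, u s) (∫ s in τ..τ + h, v s)

theorem hasDerivAt_windowDist {u v : ℝ → H} (hu : Continuous u) (hv : Continuous v) (h τ : ℝ) :
    HasDerivAt (windowDist u v h)
      (h * (1 / 2 * ‖u (τ + h)‖ ^ 2 - 1 / 2 * ‖u τ‖ ^ 2)
        + h * (1 / 2 * ‖v (τ + h)‖ ^ 2 - 1 / 2 * ‖v τ‖ ^ 2)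
        - (inner ℝ (u (τ + h) - u τ) (∫ s in τ..τ + h, v s)
          + inner ℝ (∫ s in τ..τ + h, u s) (v (τ + h) - v τ))) τ := by
  have h1 := hasDerivAt_integral_window (hu.norm.pow 2) h τ
  have h2 := hasDerivAt_integral_window (hv.norm.pow 2) h τ
  have h3 := (hasDerivAt_integral_window hu h τ).inner ℝ (hasDerivAt_integral_window hv h τ)
  refine ((((h1.const_mul (1 / 2)).const_mul h).add ((h2.const_mul (1 / 2)).const_mul h)).sub
    h3).congr_deriv ?_
  simp only [Pi.pow_apply]
  ring

theorem tendsto_windowDist {u v : ℝ → H} (hu : Continuous u) (hv : Continuous v) (τ : ℝ) :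
    Tendsto (fun h : ℝ => h⁻¹ ^ 2 * windowDist u v h τ) (𝓝[>] 0)
      (𝓝 (1 / 2 * ‖u τ - v τ‖ ^ 2)) := by
  have h1 := tendsto_average_window (hu.norm.pow 2) τ
  have h2 := tendsto_average_window (hv.norm.pow 2) τ
  have h3 := (tendsto_average_window hu τ).inner (𝕜 := ℝ) (tendsto_average_window hv τ)
  have h4 := ((h1.const_mul (1 / 2)).add (h2.const_mul (1 / 2))).sub h3
  have e : 1 / 2 * ‖u τ‖ ^ 2 + 1 / 2 * ‖v τ‖ ^ 2 - inner ℝ (u τ) (v τ)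
      = 1 / 2 * ‖u τ - v τ‖ ^ 2 := by
    rw [norm_sub_sq_real]; ring
  rw [← e]
  refine h4.congr' ?_
  filter_upwards [self_mem_nhdsWithin] with h hh
  have hh' : h ≠ 0 := ne_of_gt hh
  simp only [windowDist, smul_eq_mul, real_inner_smul_left, real_inner_smul_right, Pi.pow_apply]
  field_simp

omit [InnerProductSpace ℝ H] [CompleteSpace H] in
theorem _root_.MeasureTheory.IntegrableOn.intervalIntegrable_of_subset_Ioc {g : ℝ → H}
    {T a b : ℝ} (hg : IntegrableOn g (Ioc 0 T)) (ha : 0 ≤ a) (hab : a ≤ b) (hb : b ≤ T) :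
    IntervalIntegrable g volume a b := by
  rw [intervalIntegrable_iff, uIoc_of_le hab]
  exact hg.mono_set (Ioc_subset_Ioc ha hb)

/-- The double integral `windowDist` over `[t, t + h]²` exceeds the one over `[0, h]²` by at most
`2 h² ε ‖f‖_{L¹}`, where `ε` is the modulus of continuity of the curves at scale `h`. -/
theorem windowDist_le {u v f : ℝ → H} {φ φ' : ℝ → ℝ} {T h ε t : ℝ} (hh : 0 < h)
    (ht : 0 ≤ t) (htT : t + h ≤ T)
    (hu : Continuous u) (hv : Continuous v) (hf : IntegrableOn f (Ioc 0 T))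
    (hφ : IntegrableOn φ (Ioc 0 T)) (hφ' : IntegrableOn φ' (Ioc 0 T)) (hε : 0 ≤ ε)
    (huε : ∀ s ∈ Icc 0 T, ∀ t ∈ Icc 0 T, |t - s| ≤ h → ‖u t - u s‖ ≤ ε)
    (hvε : ∀ s ∈ Icc 0 T, ∀ t ∈ Icc 0 T, |t - s| ≤ h → ‖v t - v s‖ ≤ ε)
    (hev : ∀ᵐ s ∂(volume.restrict (Ioc 0 T)), ∀ a b, 0 ≤ a → a ≤ b → b ≤ T →
      1 / 2 * ‖u b - v s‖ ^ 2 - 1 / 2 * ‖u a - v s‖ ^ 2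
        ≤ ∫ t in a..b, (φ' s - φ t + inner ℝ (f t) (u t - v s)))
    (hev' : ∀ᵐ s ∂(volume.restrict (Ioc 0 T)), ∀ a b, 0 ≤ a → a ≤ b → b ≤ T →
      1 / 2 * ‖v b - u s‖ ^ 2 - 1 / 2 * ‖v a - u s‖ ^ 2
        ≤ ∫ t in a..b, (φ s - φ' t + inner ℝ (f t) (v t - u s))) :
    windowDist u v h t ≤ windowDist u v h 0 + 2 * h ^ 2 * ε * ∫ s in Ioc 0 T, ‖f s‖ := by
  set F : ℝ → ℝ := (Ioc 0 T).indicator fun s => ‖f s‖ with hF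
  have hFi : Integrable F := (integrable_indicator_iff measurableSet_Ioc).2 hf.norm
  have hF0 : ∀ s, 0 ≤ F s := fun s => indicator_nonneg (fun _ _ => norm_nonneg _) s
  -- With the primitive `P` of `‖f‖`, the rate `2 h ε ∫ ‖f‖` over `[τ, τ + h]` is the derivative of
  -- `2 h ε ∫ P` over the same window, so that the bound on the growth becomes monotonicity.
  set P : ℝ → ℝ := fun r => ∫ s in (0 : ℝ)..r, F s with hP
  have hPc : Continuous P :=
    intervalIntegral.continuous_primitive (fun _ _ => hFi.intervalIntegrable) 0
  have hsub : ∀ {a b}, 0 ≤ a → b ≤ T → Ioc a b ⊆ Ioc 0 T := fun ha hb => Ioc_subset_Ioc ha hb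
  have hPF : ∀ a b, 0 ≤ a → a ≤ b → b ≤ T → ∫ s in a..b, ‖f s‖ = P b - P a := by
    intro a b ha hab hb
    rw [hP]
    dsimp only
    rw [intervalIntegral.integral_interval_sub_left hFi.intervalIntegrable hFi.intervalIntegrable]
    refine intervalIntegral.integral_congr_ae (Eventually.of_forall fun s hs => ?_)
    rw [uIoc_of_le hab] at hs
    rw [hF, indicator_of_mem (hsub ha hb hs)]
  have hderiv : ∀ τ, HasDerivAt (fun τ => windowDist u v h τ - 2 * h * ε * ∫ s in τ..τ + h, P s)
      ((h * (1 / 2 * ‖u (τ + h)‖ ^ 2 - 1 / 2 * ‖u τ‖ ^ 2)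
        + h * (1 / 2 * ‖v (τ + h)‖ ^ 2 - 1 / 2 * ‖v τ‖ ^ 2)
        - (inner ℝ (u (τ + h) - u τ) (∫ s in τ..τ + h, v s)
          + inner ℝ (∫ s in τ..τ + h, u s) (v (τ + h) - v τ)))
        - 2 * h * ε * (P (τ + h) - P τ)) τ := fun τ =>
    (hasDerivAt_windowDist hu hv h τ).sub ((hasDerivAt_integral_window hPc h τ).const_mul _)
  have hanti : AntitoneOn (fun τ => windowDist u v h τ - 2 * h * ε * ∫ s in τ..τ + h, P s)
      (Icc 0 (T - h)) := by
    refine antitoneOn_of_deriv_nonpos (convex_Icc _ _)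
      (fun τ _ => (hderiv τ).continuousAt.continuousWithinAt)
      (fun τ _ => (hderiv τ).differentiableAt.differentiableWithinAt) fun τ hτ => ?_
    rw [interior_Icc] at hτ
    have h0 : 0 ≤ τ := hτ.1.le
    have hT : τ + h ≤ T := by linarith [hτ.2]
    have hle : τ ≤ τ + h := by linarith
    have hmem : ∀ s ∈ Icc τ (τ + h), s ∈ Icc 0 T := fun s hs => ⟨h0.trans hs.1, hs.2.trans hT⟩
    have habs : ∀ s ∈ Icc τ (τ + h), ∀ r ∈ Icc τ (τ + h), |r - s| ≤ h := by
      intro s hs r hr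
      rw [abs_le]
      constructor <;> linarith [hs.1, hs.2, hr.1, hr.2]
    have hae := ae_restrict_of_ae_restrict_of_subset (hsub h0 hT) hev
    have hae' := ae_restrict_of_ae_restrict_of_subset (hsub h0 hT) hev'
    have := averaged_evi_add hle hu hv (hf.intervalIntegrable_of_subset_Ioc h0 hle hT)
      (hφ.intervalIntegrable_of_subset_Ioc h0 hle hT)
      (hφ'.intervalIntegrable_of_subset_Ioc h0 hle hT)
      (fun s hs r hr => huε s (hmem s hs) r (hmem r hr) (habs s hs r hr))
      (fun s hs r hr => hvε s (hmem s hs) r (hmem r hr) (habs s hs r hr))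
      (hae.mono fun s hs => hs _ _ h0 hle hT) (hae'.mono fun s hs => hs _ _ h0 hle hT)
    rw [hPF _ _ h0 hle hT] at this
    rw [(hderiv τ).deriv]
    simp only [add_sub_cancel_left] at this
    linarith
  have hmono := hanti ⟨le_rfl, by linarith⟩ ⟨ht, by linarith⟩ ht
  simp only at hmono
  have hPT : ∀ r, P r ≤ ∫ s in Ioc 0 T, ‖f s‖ := by
    intro r
    have e : ∫ s, F s = ∫ s in Ioc 0 T, ‖f s‖ := integral_indicator measurableSet_Ioc
    rw [← e]
    rcases le_total 0 r with hr | hr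
    · rw [hP]
      dsimp only
      rw [intervalIntegral.integral_of_le hr]
      exact setIntegral_le_integral hFi (Eventually.of_forall hF0)
    · rw [hP]
      dsimp only
      rw [intervalIntegral.integral_of_ge hr]
      have := setIntegral_nonneg (μ := volume) (measurableSet_Ioc (a := r) (b := 0))
        fun s _ => hF0 s
      have h2 := integral_nonneg (μ := volume) (f := F) hF0
      linarith
  have hP0 : ∀ r, 0 ≤ r → 0 ≤ P r := fun r hr =>
    intervalIntegral.integral_nonneg hr fun s _ => hF0 s
  have h1 : ∫ s in t..t + h, P s ≤ h * ∫ s in Ioc 0 T, ‖f s‖ := by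
    have := intervalIntegral.integral_mono (by linarith) (hPc.intervalIntegrable t (t + h))
      (intervalIntegrable_const (μ := volume)) hPT
    rw [intervalIntegral.integral_const] at this
    simpa using this
  have h2 : 0 ≤ ∫ s in (0 : ℝ)..0 + h, P s :=
    intervalIntegral.integral_nonneg (by linarith) fun s hs => hP0 s hs.1
  have h3 : 2 * h * ε * ∫ s in t..t + h, P s ≤ 2 * h * ε * (h * ∫ s in Ioc 0 T, ‖f s‖) := by gcongr
  have h4 : 0 ≤ 2 * h * ε * ∫ s in (0 : ℝ)..0 + h, P s := by positivity
  nlinarith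

/-- The case of `eq_of_evi` in which the curves are continuous on the whole line: divide
`windowDist_le` by `h²` and let first `h → 0` and then `ε → 0`. -/
theorem eq_of_continuous_of_evi {u v f : ℝ → H} {φ φ' : ℝ → ℝ} {T : ℝ} (hT : 0 < T)
    (hu : Continuous u) (hv : Continuous v) (hf : IntegrableOn f (Ioc 0 T))
    (hφ : IntegrableOn φ (Ioc 0 T)) (hφ' : IntegrableOn φ' (Ioc 0 T)) (h0 : u 0 = v 0)
    (hev : ∀ᵐ s ∂(volume.restrict (Ioc 0 T)), ∀ a b, 0 ≤ a → a ≤ b → b ≤ T →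
      1 / 2 * ‖u b - v s‖ ^ 2 - 1 / 2 * ‖u a - v s‖ ^ 2
        ≤ ∫ t in a..b, (φ' s - φ t + inner ℝ (f t) (u t - v s)))
    (hev' : ∀ᵐ s ∂(volume.restrict (Ioc 0 T)), ∀ a b, 0 ≤ a → a ≤ b → b ≤ T →
      1 / 2 * ‖v b - u s‖ ^ 2 - 1 / 2 * ‖v a - u s‖ ^ 2
        ≤ ∫ t in a..b, (φ s - φ' t + inner ℝ (f t) (v t - u s))) :
    EqOn u v (Icc 0 T) := by
  have hosc : ∀ w : ℝ → H, Continuous w → ∀ ε > 0, ∀ᶠ h : ℝ in 𝓝[>] 0,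
      ∀ s ∈ Icc 0 T, ∀ t ∈ Icc 0 T, |t - s| ≤ h → ‖w t - w s‖ ≤ ε := by
    intro w hw ε hε
    have := isCompact_Icc.uniformContinuousOn_of_continuous (hw.continuousOn (s := Icc 0 T))
    obtain ⟨δ, hδ, hδ'⟩ := Metric.uniformContinuousOn_iff.1 this ε hε
    filter_upwards [Ioo_mem_nhdsGT hδ] with h hh s hs t ht hst
    have := hδ' t ht s hs (by rw [Real.dist_eq]; exact hst.trans_lt hh.2)
    rw [dist_eq_norm] at this
    exact this.le
  have hmain : ∀ t ∈ Ico 0 T, u t = v t := by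
    intro t ht
    have hε : ∀ ε > 0, 1 / 2 * ‖u t - v t‖ ^ 2 ≤ 2 * ε * ∫ s in Ioc 0 T, ‖f s‖ := by
      intro ε hε
      have l1 := tendsto_windowDist hu hv t
      have l2 := (tendsto_windowDist hu hv 0).add_const (2 * ε * ∫ s in Ioc 0 T, ‖f s‖)
      rw [h0] at l2
      simp only [sub_self, norm_zero, ne_eq, OfNat.ofNat_ne_zero, not_false_eq_true, zero_pow,
        mul_zero, zero_add] at l2
      refine le_of_tendsto_of_tendsto l1 l2 ?_
      filter_upwards [self_mem_nhdsWithin, hosc u hu ε hε, hosc v hv ε hε,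
        Ioo_mem_nhdsGT (sub_pos.2 ht.2)] with h hh hu1 hv1 hhT
      have hh' : (0 : ℝ) < h := hh
      have := windowDist_le hh ht.1 (by linarith [hhT.2]) hu hv hf hφ hφ' hε.le hu1 hv1 hev hev'
      calc h⁻¹ ^ 2 * windowDist u v h t
          ≤ h⁻¹ ^ 2 * (windowDist u v h 0 + 2 * h ^ 2 * ε * ∫ s in Ioc 0 T, ‖f s‖) := by gcongr
        _ = _ := by field_simp
    have hlim : Tendsto (fun ε : ℝ => 2 * ε * ∫ s in Ioc 0 T, ‖f s‖) (𝓝[>] 0) (𝓝 0) := by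
      have : Continuous fun ε : ℝ => 2 * ε * ∫ s in Ioc 0 T, ‖f s‖ := by fun_prop
      simpa using (this.tendsto 0).mono_left nhdsWithin_le_nhds
    have := ge_of_tendsto hlim (eventually_mem_nhdsWithin.mono hε)
    have h2 : ‖u t - v t‖ ^ 2 ≤ 0 := by linarith
    have h3 : ‖u t - v t‖ = 0 := pow_eq_zero_iff two_ne_zero |>.1 (le_antisymm h2 (sq_nonneg _))
    exact sub_eq_zero.1 (norm_eq_zero.1 h3)
  -- windows starting at `T` leave `[0, T]`, so the end point is reached by continuity
  have hcl : EqOn u v (closure (Ico 0 T)) := Set.EqOn.closure hmain hu hv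
  rwa [closure_Ico hT.ne] at hcl

/-- **Uniqueness of integral solutions** (Bénilan). Two curves in a Hilbert space which agree
initially and satisfy the evolution variational inequality relative to each other coincide. -/
theorem eq_of_evi {u v f : ℝ → H} {φ φ' : ℝ → ℝ} {T : ℝ} (hT : 0 < T)
    (hu : ContinuousOn u (Icc 0 T)) (hv : ContinuousOn v (Icc 0 T))
    (hf : IntegrableOn f (Ioc 0 T))
    (hφ : IntegrableOn φ (Ioc 0 T)) (hφ' : IntegrableOn φ' (Ioc 0 T)) (h0 : u 0 = v 0)
    (hev : ∀ᵐ s ∂(volume.restrict (Ioc 0 T)), ∀ a b, 0 ≤ a → a ≤ b → b ≤ T →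
      1 / 2 * ‖u b - v s‖ ^ 2 - 1 / 2 * ‖u a - v s‖ ^ 2
        ≤ ∫ t in a..b, (φ' s - φ t + inner ℝ (f t) (u t - v s)))
    (hev' : ∀ᵐ s ∂(volume.restrict (Ioc 0 T)), ∀ a b, 0 ≤ a → a ≤ b → b ≤ T →
      1 / 2 * ‖v b - u s‖ ^ 2 - 1 / 2 * ‖v a - u s‖ ^ 2
        ≤ ∫ t in a..b, (φ s - φ' t + inner ℝ (f t) (v t - u s))) :
    EqOn u v (Icc 0 T) := by
  have hext : ∀ w : ℝ → H, ContinuousOn w (Icc 0 T) →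
      ∃ w' : ℝ → H, Continuous w' ∧ EqOn w' w (Icc 0 T) := fun w hw =>
    ⟨IccExtend hT.le ((Icc 0 T).domRestrict w),
      (continuousOn_iff_continuous_domRestrict.1 hw).Icc_extend',
      fun t ht => by rw [IccExtend_of_mem hT.le _ ht]; rfl⟩
  have htrans : ∀ {u v u' v' : ℝ → H} {φ φ' : ℝ → ℝ}, EqOn u' u (Icc 0 T) → EqOn v' v (Icc 0 T) →
      (∀ᵐ s ∂(volume.restrict (Ioc 0 T)), ∀ a b, 0 ≤ a → a ≤ b → b ≤ T →
      1 / 2 * ‖u b - v s‖ ^ 2 - 1 / 2 * ‖u a - v s‖ ^ 2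
        ≤ ∫ t in a..b, (φ' s - φ t + inner ℝ (f t) (u t - v s))) →
      (∀ᵐ s ∂(volume.restrict (Ioc 0 T)), ∀ a b, 0 ≤ a → a ≤ b → b ≤ T →
      1 / 2 * ‖u' b - v' s‖ ^ 2 - 1 / 2 * ‖u' a - v' s‖ ^ 2
        ≤ ∫ t in a..b, (φ' s - φ t + inner ℝ (f t) (u' t - v' s))) := by
    intro u v u' v' φ φ' hu' hv' hae
    filter_upwards [hae, ae_restrict_mem measurableSet_Ioc] with s hs hsT a b ha hab hb
    have hs' := hs a b ha hab hb
    rw [hu' ⟨ha.trans hab, hb⟩, hu' ⟨ha, hab.trans hb⟩, hv' (Ioc_subset_Icc_self hsT)]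
    refine hs'.trans (le_of_eq (intervalIntegral.integral_congr fun t ht => ?_))
    rw [uIcc_of_le hab] at ht
    rw [hu' ⟨ha.trans ht.1, ht.2.trans hb⟩]
  obtain ⟨u', hu'c, hu'⟩ := hext u hu
  obtain ⟨v', hv'c, hv'⟩ := hext v hv
  have hmem : (0 : ℝ) ∈ Icc 0 T := ⟨le_rfl, hT.le⟩
  have := eq_of_continuous_of_evi hT hu'c hv'c hf hφ hφ' (by rw [hu' hmem, hv' hmem, h0])
    (htrans hu' hv' hev) (htrans hv' hu' hev')
  exact fun t ht => by rw [← hu' ht, ← hv' ht, this ht]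

end IntegralSolutions

/-! ### Test functions -/

/-- The `n`-th standard mollifier is supported in the ball of radius `1 / (n + 1)`. -/
def bump (E : Type*) [NormedAddCommGroup E] (n : ℕ) : ContDiffBump (0 : E) where
  rIn := 1 / (2 * (n + 1))
  rOut := 1 / (n + 1)
  rIn_pos := by positivity
  rIn_lt_rOut := by
    have : (0 : ℝ) < n + 1 := by positivity
    rw [div_lt_div_iff₀ (by positivity) this]
    linarith

theorem tendsto_rOut_bump (E : Type*) [NormedAddCommGroup E] :
    Tendsto (fun n => (bump E n).rOut) atTop (𝓝 0) :=
  tendsto_one_div_add_atTop_nhds_zero_nat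

theorem rOut_bump_le (E : Type*) [NormedAddCommGroup E] (n : ℕ) :
    (bump E n).rOut ≤ 2 * (bump E n).rIn := by
  refine le_of_eq ?_
  simp only [bump]
  field_simp

theorem IsTest.eq_zero {F : Type*} [NormedAddCommGroup F] [NormedSpace ℝ F] {U : Set F}
    {φ : F → ℝ} (h : IsTest U φ) {x : F} (hx : x ∉ U) : φ x = 0 :=
  image_eq_zero_of_notMem_tsupport fun h' => hx (h.2.2 h')

/-- A bounded open set `U` has test functions with values in `[0, 1]` which converge pointwise to
its indicator function. -/
theorem exists_isTest_tendsto {F : Type*} [NormedAddCommGroup F] [NormedSpace ℝ F]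
    [FiniteDimensional ℝ F] {U : Set F} (hU : IsOpen U) (hb : Bornology.IsBounded U) :
    ∃ φ : ℕ → F → ℝ, (∀ k, IsTest U (φ k)) ∧ (∀ k x, φ k x ∈ Icc (0 : ℝ) 1) ∧
      ∀ x, Tendsto (fun k => φ k x) atTop (𝓝 (U.indicator 1 x)) := by
  -- `U = {f ≠ 0}` for a smooth `f ≥ 0`; the `k`-th cutoff is supported in `{f ≥ 1 / k}`
  obtain ⟨f, hfU, hf, hfr⟩ := hU.exists_contDiff_support_eq (n := ⊤)
  have hf0 : ∀ x, 0 ≤ f x := fun x => (hfr (mem_range_self x)).1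
  have hts : ∀ k : ℕ, tsupport (fun x => Real.smoothTransition (k * f x - 1)) ⊆
      {x | 1 ≤ k * f x} := fun k => by
    refine closure_minimal (fun x hx => ?_)
      (isClosed_le continuous_const (continuous_const.mul hf.continuous))
    by_contra h
    rw [mem_ofPred_eq, not_le] at h
    exact hx (Real.smoothTransition.zero_of_nonpos (by linarith))
  have hsub : ∀ k : ℕ, {x | 1 ≤ k * f x} ⊆ U := fun k x hx => by
    rw [← hfU, Function.mem_support]
    intro h0
    rw [mem_ofPred_eq, h0] at hx
    norm_num at hx
  refine ⟨fun k x => Real.smoothTransition (k * f x - 1), fun k => ⟨?_, ?_, ?_⟩,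
    fun k x => ⟨Real.smoothTransition.nonneg _, Real.smoothTransition.le_one _⟩, fun x => ?_⟩
  · exact Real.smoothTransition.contDiff.comp ((contDiff_const.mul hf).sub contDiff_const)
  · exact Metric.isCompact_of_isClosed_isBounded (isClosed_tsupport _)
      (hb.subset ((hts k).trans (hsub k)))
  · exact (hts k).trans (hsub k)
  · by_cases hx : x ∈ U
    · rw [indicator_of_mem hx]
      have hpos : 0 < f x := (hf0 x).lt_of_ne' (by rwa [← hfU] at hx)
      have : Tendsto (fun k : ℕ => (k : ℝ) * f x) atTop atTop :=
        tendsto_natCast_atTop_atTop.atTop_mul_const hpos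
      refine tendsto_const_nhds.congr' ?_
      filter_upwards [this.eventually_ge_atTop 2] with k hk
      rw [Real.smoothTransition.one_of_one_le (by linarith)]
      rfl
    · rw [indicator_of_notMem hx]
      have : f x = 0 := by
        by_contra h
        exact hx (hfU ▸ h)
      simp [this, Real.smoothTransition.zero_of_nonpos]

theorem isTest_bump_sub {E : Type*} [NormedAddCommGroup E] [NormedSpace ℝ E]
    [FiniteDimensional ℝ E] [MeasurableSpace E] [BorelSpace E] [HasContDiffBump E] {μ : Measure E}
    [μ.IsAddHaarMeasure] {U : Set E}
    {x : E} {n : ℕ} (h : Metric.closedBall x (bump E n).rOut ⊆ U) :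
    IsTest U fun y => (bump E n).normed μ (x - y) := by
  have hsupp : tsupport (fun y => (bump E n).normed μ (x - y)) ⊆
      Metric.closedBall x (bump E n).rOut := by
    refine closure_minimal (fun y hy => ?_) Metric.isClosed_closedBall
    have : x - y ∈ Function.support ((bump E n).normed μ) := hy
    rw [ContDiffBump.support_normed_eq, mem_ball_zero_iff] at this
    rw [Metric.mem_closedBall, dist_comm, dist_eq_norm]
    exact this.le
  refine ⟨(bump E n).contDiff_normed.comp (contDiff_const.sub contDiff_id), ?_, hsupp.trans h⟩
  exact (isCompact_closedBall _ _).of_isClosed_subset (isClosed_tsupport _) hsupp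

theorem eventually_closedBall_bump_subset {E : Type*} [NormedAddCommGroup E]
    {U : Set E} (hU : IsOpen U) {x : E} (hx : x ∈ U) :
    ∀ᶠ n in atTop, Metric.closedBall x (bump E n).rOut ⊆ U := by
  obtain ⟨ε, hε, h⟩ := Metric.isOpen_iff.1 hU x hx
  filter_upwards [(tendsto_rOut_bump E).eventually_lt_const hε] with n hn
  exact (Metric.closedBall_subset_ball hn).trans h

/-- A function on an interval which is nonnegative as a distribution is nonnegative almost
everywhere. -/
theorem ae_nonneg_of_forall_isTest {T : ℝ} {G : ℝ → ℝ} (hG : IntegrableOn G (Ioo 0 T))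
    (h : ∀ η : ℝ → ℝ, IsTest (Ioo 0 T) η → (∀ t, 0 ≤ η t) → 0 ≤ ∫ t in Ioo 0 T, η t * G t) :
    ∀ᵐ t ∂(volume.restrict (Ioo 0 T)), 0 ≤ G t := by
  have hi : Integrable ((Ioo 0 T).indicator G) := (integrable_indicator_iff measurableSet_Ioo).2 hG
  rw [ae_restrict_iff' measurableSet_Ioo]
  filter_upwards [ContDiffBump.ae_convolution_tendsto_right_of_locallyIntegrable
    (tendsto_rOut_bump ℝ) (Eventually.of_forall (rOut_bump_le ℝ)) hi.locallyIntegrable]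
    with t ht htT
  rw [indicator_of_mem htT] at ht
  refine ge_of_tendsto ht ?_
  filter_upwards [eventually_closedBall_bump_subset isOpen_Ioo htT] with n hn
  rw [convolution_eq_swap]
  have := h _ (isTest_bump_sub (μ := volume) hn) fun s => (bump ℝ n).nonneg_normed _
  rw [← integral_indicator measurableSet_Ioo] at this
  refine this.trans_eq (integral_congr_ae (Eventually.of_forall fun s => ?_))
  by_cases hs : s ∈ Ioo 0 T <;> simp [hs]

/-- A smooth approximation of the Heaviside function: the primitive of a mollifier. The supports
of the mollifiers lie in `[-1, 1]`, which allows the lower limit `-1`. -/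
def smoothStep (n : ℕ) (t : ℝ) : ℝ := ∫ s in (-1 : ℝ)..t, (bump ℝ n).normed volume s

theorem hasDerivAt_smoothStep (n : ℕ) (t : ℝ) :
    HasDerivAt (smoothStep n) ((bump ℝ n).normed volume t) t :=
  have hc : Continuous ((bump ℝ n).normed volume) := (bump ℝ n).continuous_normed
  intervalIntegral.integral_hasDerivAt_right (hc.intervalIntegrable _ _)
    hc.stronglyMeasurable.stronglyMeasurableAtFilter hc.continuousAt

theorem contDiff_smoothStep (n : ℕ) : ContDiff ℝ ∞ (smoothStep n) := by
  rw [contDiff_infty_iff_deriv]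
  refine ⟨fun t => (hasDerivAt_smoothStep n t).differentiableAt, ?_⟩
  rw [show deriv (smoothStep n) = (bump ℝ n).normed volume from
    funext fun t => (hasDerivAt_smoothStep n t).deriv]
  exact (bump ℝ n).contDiff_normed

theorem monotone_smoothStep (n : ℕ) : Monotone (smoothStep n) := by
  refine monotone_of_deriv_nonneg (fun t => (hasDerivAt_smoothStep n t).differentiableAt)
    fun t => ?_
  rw [(hasDerivAt_smoothStep n t).deriv]
  exact (bump ℝ n).nonneg_normed t

theorem smoothStep_of_le {n : ℕ} {t : ℝ} (ht : t ≤ -(bump ℝ n).rOut) : smoothStep n t = 0 := by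
  have h1 : (bump ℝ n).rOut ≤ 1 := by
    simp only [bump]
    rw [div_le_one (by positivity)]
    linarith [(Nat.cast_nonneg n : (0 : ℝ) ≤ n)]
  refine intervalIntegral.integral_zero_ae (Eventually.of_forall fun s hs => ?_)
  have hs' : s ≤ -(bump ℝ n).rOut := by
    rcases le_total (-1) t with h | h
    · rw [uIoc_of_le h] at hs; exact hs.2.trans ht
    · rw [uIoc_of_ge h] at hs; exact hs.2.trans (by linarith)
  have : s ∉ Function.support ((bump ℝ n).normed volume) := by
    rw [ContDiffBump.support_normed_eq, mem_ball_zero_iff, Real.norm_eq_abs, not_lt]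
    exact le_abs.2 (Or.inr (by linarith))
  simpa using this

theorem smoothStep_of_ge {n : ℕ} {t : ℝ} (ht : (bump ℝ n).rOut ≤ t) : smoothStep n t = 1 := by
  have h1 : (bump ℝ n).rOut ≤ 1 := by
    simp only [bump]
    rw [div_le_one (by positivity)]
    linarith [(Nat.cast_nonneg n : (0 : ℝ) ≤ n)]
  have h0 := (bump ℝ n).rOut_pos
  rw [← (bump ℝ n).integral_normed (μ := volume), smoothStep,
    intervalIntegral.integral_of_le (by linarith)]
  refine setIntegral_eq_integral_of_ae_compl_eq_zero ?_
  -- the mollifier is supported in the open ball of radius `rOut ≤ 1`, so inside `(-1, t]`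
  refine Eventually.of_forall fun s hs => ?_
  have : s ∉ Function.support ((bump ℝ n).normed volume) := by
    rw [ContDiffBump.support_normed_eq, mem_ball_zero_iff, Real.norm_eq_abs, not_lt]
    rw [mem_Ioc, not_and_or, not_lt, not_le] at hs
    rcases hs with hs | hs
    · exact le_abs.2 (Or.inr (by linarith))
    · exact le_abs.2 (Or.inl (by linarith))
  simpa using this

/-- If `F` is continuous and `F' ≤ G` as distributions on `(0, T)`, then
`F b - F a ≤ ∫ₐᵇ G`. -/
theorem sub_le_integral_of_forall_isTest {T : ℝ} {F G : ℝ → ℝ} (hF : Continuous F)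
    (hG : IntegrableOn G (Ioo 0 T))
    (h : ∀ η : ℝ → ℝ, IsTest (Ioo 0 T) η → (∀ t, 0 ≤ η t) →
      - ∫ t in Ioo 0 T, deriv η t * F t ≤ ∫ t in Ioo 0 T, η t * G t) :
    ∀ a b, 0 ≤ a → a ≤ b → b ≤ T → F b - F a ≤ ∫ t in a..b, G t := by
  set G' : ℝ → ℝ := (Ioo 0 T).indicator G with hG'
  have hi : Integrable G' := (integrable_indicator_iff measurableSet_Ioo).2 hG
  -- the open interval, by testing with smooth approximations of the indicator of `[a, b]`
  have hint : ∀ a b, 0 < a → a < b → b < T → F b - F a ≤ ∫ t in a..b, G' t := by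
    intro a b ha hab hb
    have haT : a ∈ Ioo 0 T := ⟨ha, hab.trans hb⟩
    have hbT : b ∈ Ioo 0 T := ⟨ha.trans hab, hb⟩
    have l1 : Tendsto (fun n => (convolution ((bump ℝ n).normed volume) F
        (ContinuousLinearMap.lsmul ℝ ℝ) volume b) - (convolution ((bump ℝ n).normed volume) F
        (ContinuousLinearMap.lsmul ℝ ℝ) volume a)) atTop (𝓝 (F b - F a)) :=
      (ContDiffBump.convolution_tendsto_right_of_continuous (tendsto_rOut_bump ℝ) hF b).sub
        (ContDiffBump.convolution_tendsto_right_of_continuous (tendsto_rOut_bump ℝ) hF a)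
    have l2 : Tendsto (fun n => ∫ t, (smoothStep n (t - a) - smoothStep n (t - b)) * G' t) atTop
        (𝓝 (∫ t, (Ioc a b).indicator G' t)) := by
      have h01 : ∀ n t, smoothStep n t ∈ Icc (0 : ℝ) 1 := fun n t => by
        constructor
        · rw [← smoothStep_of_le (n := n) (min_le_right t _)]
          exact monotone_smoothStep n (min_le_left _ _)
        · rw [← smoothStep_of_ge (n := n) (le_max_right t _)]
          exact monotone_smoothStep n (le_max_left _ _)
      refine tendsto_integral_of_dominated_convergence (fun t => ‖G' t‖) (fun n => ?_) hi.norm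
        (fun n => Eventually.of_forall fun t => ?_) ?_
      · refine (Continuous.aestronglyMeasurable ?_).mul hi.aestronglyMeasurable
        have := (contDiff_smoothStep n).continuous
        fun_prop
      · rw [norm_mul]
        refine mul_le_of_le_one_left (norm_nonneg _) ?_
        rw [Real.norm_eq_abs, abs_le]
        constructor <;> linarith [(h01 n (t - a)).1, (h01 n (t - a)).2, (h01 n (t - b)).1,
          (h01 n (t - b)).2]
      · have hstep : ∀ t ≠ 0, Tendsto (fun n => smoothStep n t) atTop
            (𝓝 (if 0 < t then 1 else 0)) := by
          intro t ht
          refine tendsto_const_nhds.congr' ?_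
          filter_upwards [(tendsto_rOut_bump ℝ).eventually_lt_const (abs_pos.2 ht)] with n hn
          rcases lt_or_gt_of_ne ht with h | h
          · rw [abs_of_neg h] at hn
            rw [if_neg h.not_gt, smoothStep_of_le (by linarith)]
          · rw [abs_of_pos h] at hn
            rw [if_pos h, smoothStep_of_ge hn.le]
        have hne : ∀ c : ℝ, ∀ᵐ t : ℝ, t ≠ c := fun c => by simp [ae_iff, measure_singleton]
        filter_upwards [hne a, hne b] with t hta htb
        have := ((hstep (t - a) (sub_ne_zero.2 hta)).sub
          (hstep (t - b) (sub_ne_zero.2 htb))).mul_const (G' t)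
        convert this using 2
        simp only [sub_pos, indicator, mem_Ioc]
        rcases lt_or_gt_of_ne hta with h1 | h1 <;> rcases lt_or_gt_of_ne htb with h2 | h2
        · simp [h1.not_gt, h2.not_gt]
        · linarith
        · simp [h1, h2.le, h2.not_gt]
        · simp [h1, h2, h2.not_ge]
    rw [integral_indicator measurableSet_Ioc, ← intervalIntegral.integral_of_le hab.le] at l2
    refine le_of_tendsto_of_tendsto l1 l2 ?_
    filter_upwards [eventually_closedBall_bump_subset isOpen_Ioo haT,
      eventually_closedBall_bump_subset isOpen_Ioo hbT] with n hna hnb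
    have hr := (bump ℝ n).rOut_pos
    have hη : IsTest (Ioo 0 T) fun t => smoothStep n (t - a) - smoothStep n (t - b) := by
      have hs : tsupport (fun t => smoothStep n (t - a) - smoothStep n (t - b)) ⊆
          Icc (a - (bump ℝ n).rOut) (b + (bump ℝ n).rOut) := by
        refine closure_minimal (fun t ht => ?_) isClosed_Icc
        by_contra hc
        rw [mem_Icc, not_and_or, not_le, not_le] at hc
        refine ht ?_
        rcases hc with hc | hc
        · simp only
          rw [smoothStep_of_le (by linarith), smoothStep_of_le (by linarith), sub_zero]
        · simp only
          rw [smoothStep_of_ge (by linarith), smoothStep_of_ge (by linarith), sub_self]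
      refine ⟨?_, isCompact_Icc.of_isClosed_subset (isClosed_tsupport _) hs, hs.trans ?_⟩
      · have := contDiff_smoothStep n
        exact (this.comp (contDiff_id.sub contDiff_const)).sub
          (this.comp (contDiff_id.sub contDiff_const))
      · intro t ht
        have h1 := @hna (a - (bump ℝ n).rOut) (by simp [abs_of_pos hr])
        have h2 := @hnb (b + (bump ℝ n).rOut) (by simp [abs_of_pos hr])
        exact ⟨h1.1.trans_le ht.1, ht.2.trans_lt h2.2⟩
    have hη0 : ∀ t, 0 ≤ smoothStep n (t - a) - smoothStep n (t - b) := fun t =>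
      sub_nonneg.2 (monotone_smoothStep n (by linarith))
    have hd : ∀ t, deriv (fun t => smoothStep n (t - a) - smoothStep n (t - b)) t
        = (bump ℝ n).normed volume (a - t) - (bump ℝ n).normed volume (b - t) := by
      intro t
      rw [← (bump ℝ n).normed_neg (a - t), ← (bump ℝ n).normed_neg (b - t), neg_sub, neg_sub]
      exact (((hasDerivAt_smoothStep n (t - a)).comp_sub_const t a).sub
        ((hasDerivAt_smoothStep n (t - b)).comp_sub_const t b)).deriv
    have key := h _ hη hη0
    have hci : ∀ c, Integrable fun t => (bump ℝ n).normed volume (c - t) * F t := fun c => by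
      have ht : IsTest univ fun y => (bump ℝ n).normed volume (c - y) :=
        isTest_bump_sub (subset_univ _)
      exact (ht.1.continuous.mul hF).integrable_of_hasCompactSupport ht.2.1.mul_right
    have hzero : ∀ c, Metric.closedBall c (bump ℝ n).rOut ⊆ Ioo 0 T → ∀ t, t ∉ Ioo 0 T →
        (bump ℝ n).normed volume (c - t) = 0 := fun c hc t ht =>
      (isTest_bump_sub (μ := volume) hc).eq_zero ht
    have e1 : ∫ t in Ioo 0 T, deriv (fun t => smoothStep n (t - a) - smoothStep n (t - b)) t * F t
        = (∫ t, (bump ℝ n).normed volume (a - t) * F t)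
          - ∫ t, (bump ℝ n).normed volume (b - t) * F t := by
      rw [← integral_sub (hci a) (hci b), setIntegral_eq_integral_of_forall_compl_eq_zero]
      · exact integral_congr_ae (Eventually.of_forall fun t => by simp only [hd]; ring)
      · intro t ht
        rw [hd, hzero a hna t ht, hzero b hnb t ht]
        simp
    have e2 : ∫ t in Ioo 0 T, (smoothStep n (t - a) - smoothStep n (t - b)) * G t
        = ∫ t, (smoothStep n (t - a) - smoothStep n (t - b)) * G' t := by
      rw [← integral_indicator measurableSet_Ioo]
      refine integral_congr_ae (Eventually.of_forall fun t => ?_)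
      by_cases ht : t ∈ Ioo 0 T <;> simp [ht, hG']
    rw [e1, e2] at key
    rw [convolution_eq_swap, convolution_eq_swap]
    simp only [ContinuousLinearMap.lsmul_apply, smul_eq_mul]
    linarith
  -- the end points, by continuity of `Q = F - ∫ G`, which is nonincreasing on the open interval
  intro a b ha hab hb
  have hGG : ∫ t in a..b, G t = ∫ t in a..b, G' t := by
    rw [intervalIntegral.integral_of_le hab, intervalIntegral.integral_of_le hab,
      integral_Ioc_eq_integral_Ioo, integral_Ioc_eq_integral_Ioo]
    refine setIntegral_congr_fun measurableSet_Ioo fun t ht => ?_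
    have ht' : t ∈ Ioo 0 T := ⟨ha.trans_lt ht.1, ht.2.trans_le hb⟩
    rw [hG', indicator_of_mem ht']
  rw [hGG]
  rcases hab.eq_or_lt with rfl | hab
  · simp
  have hP : Continuous fun r => ∫ t in (0 : ℝ)..r, G' t :=
    intervalIntegral.continuous_primitive (fun _ _ => hi.intervalIntegrable) 0
  set Q : ℝ → ℝ := fun r => F r - ∫ t in (0 : ℝ)..r, G' t with hQ
  have hQc : Continuous Q := hF.sub hP
  have hQi : ∀ a b, Q b - Q a = (F b - F a) - ∫ t in a..b, G' t := fun a b => by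
    rw [← intervalIntegral.integral_interval_sub_left (a := 0) (b := b) (c := a)
      hi.intervalIntegrable hi.intervalIntegrable]
    simp only [hQ]
    ring
  have hlim : Tendsto (fun ε => Q (b - ε) - Q (a + ε)) (𝓝[>] 0) (𝓝 (Q b - Q a)) := by
    have : Continuous fun ε => Q (b - ε) - Q (a + ε) := by fun_prop
    simpa using (this.tendsto 0).mono_left nhdsWithin_le_nhds
  have : Q b - Q a ≤ 0 := by
    refine le_of_tendsto hlim ?_
    filter_upwards [Ioo_mem_nhdsGT (show (0 : ℝ) < (b - a) / 2 by linarith)] with ε hε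
    have := hint (a + ε) (b - ε) (by linarith [hε.1]) (by linarith [hε.2]) (by linarith [hε.1])
    rw [hQi]
    linarith
  rw [hQi] at this
  linarith

/-! ### Integration against vector measures with density -/

section VectorMeasure

variable {X E : Type*} [MeasurableSpace X] [NormedAddCommGroup E] [NormedSpace ℝ E]
  [CompleteSpace E]

/-- A functional on bounded measurable functions which is additive, continuous under bounded
pointwise convergence, and given by `c • μ s` on the indicators `c 1_s`, is integration
against `μ`. -/
theorem integral_vectorMeasure_eq_of_indicator {μ : VectorMeasure X E}
    (hμ : μ.variation univ < ⊤) (L : (X → ℝ) → E)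
    (hind : ∀ (c : ℝ) (s : Set X), MeasurableSet s → L (s.indicator fun _ => c) = c • μ s)
    (hadd : ∀ f g : SimpleFunc X ℝ, L (⇑f + ⇑g) = L f + L g)
    (hlim : ∀ (F : ℕ → SimpleFunc X ℝ) (f : X → ℝ) (C : ℝ), (∀ n x, ‖F n x‖ ≤ C) →
      (∀ x, Tendsto (fun n => F n x) atTop (𝓝 (f x))) →
      Tendsto (fun n => L (F n)) atTop (𝓝 (L f)))
    {f : X → ℝ} (hf : Measurable f) {C : ℝ} (hC : ∀ x, ‖f x‖ ≤ C) : ∫ᵛ x, f x ∂•μ = L f := by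
  have : IsFiniteMeasure μ.variation := ⟨hμ⟩
  have hs : ∀ g : SimpleFunc X ℝ, ∫ᵛ x, g x ∂•μ = L g := by
    intro g
    induction g using SimpleFunc.induction with
    | const c hs =>
      rename_i s
      classical
      rw [SimpleFunc.coe_piecewise, SimpleFunc.coe_const, SimpleFunc.coe_const]
      have e : s.piecewise (Function.const X c) (Function.const X 0) = s.indicator fun _ => c := by
        exact Set.piecewise_eq_indicator
      rw [e, hind c _ hs, VectorMeasure.integral_indicator_const c hs]
      rfl
    | add hd hf hg =>
      rw [SimpleFunc.coe_add, hadd, ← hf, ← hg]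
      exact VectorMeasure.integral_add (SimpleFunc.integrable_of_isFiniteMeasure _)
        (SimpleFunc.integrable_of_isFiniteMeasure _)
  set F : ℕ → SimpleFunc X ℝ := SimpleFunc.approxOn f hf univ 0 (mem_univ _)
  have hF : ∀ x, Tendsto (fun n => F n x) atTop (𝓝 (f x)) := fun x =>
    SimpleFunc.tendsto_approxOn hf (mem_univ _) (by simp)
  have hFC : ∀ n x, ‖F n x‖ ≤ C + C := fun n x =>
    (SimpleFunc.norm_approxOn_zero_le hf (mem_univ _) x n).trans (add_le_add (hC x) (hC x))
  have h1 := hlim F f (C + C) hFC hF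
  have h2 : Tendsto (fun n => ∫ᵛ x, F n x ∂•μ) atTop (𝓝 (∫ᵛ x, f x ∂•μ)) :=
    VectorMeasure.tendsto_integral_of_dominated_convergence (fun _ => C + C)
      (fun n => (F n).measurable.aestronglyMeasurable) (integrable_const _)
      (fun n => Eventually.of_forall (hFC n)) (Eventually.of_forall hF)
  simp_rw [hs] at h2
  exact tendsto_nhds_unique h2 h1

/-- Integration against the vector measure `ψ μ`. -/
theorem integral_withDensity_smul {μ : VectorMeasure X E} {ψ f : X → ℝ} (hψ : μ.Integrable ψ)
    (hf : Measurable f) {C : ℝ} (hC : ∀ x, ‖f x‖ ≤ C)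
    (hv : (μ.withDensity ψ (ContinuousLinearMap.lsmul ℝ ℝ)).variation univ < ⊤) :
    ∫ᵛ x, f x ∂•(μ.withDensity ψ (ContinuousLinearMap.lsmul ℝ ℝ)) = ∫ᵛ x, f x * ψ x ∂•μ := by
  have hi : ∀ g : SimpleFunc X ℝ, μ.Integrable (fun x => g x * ψ x) := fun g => by
    obtain ⟨C, hC⟩ := g.exists_forall_norm_le
    exact hψ.bdd_mul g.aestronglyMeasurable (Eventually.of_forall hC)
  refine integral_vectorMeasure_eq_of_indicator hv (fun f => ∫ᵛ x, f x * ψ x ∂•μ)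
    (fun c s hs => ?_) (fun f g => ?_) (fun F f C hC hF => ?_) hf hC
  · rw [VectorMeasure.withDensity_apply hψ, ← VectorMeasure.integral_smul,
      ← VectorMeasure.integral_indicator hs]
    congr 1
    funext x
    by_cases hx : x ∈ s <;> simp [hx]
  · simp_rw [Pi.add_apply, add_mul]
    exact VectorMeasure.integral_fun_add (hi f) (hi g)
  · refine VectorMeasure.tendsto_integral_of_dominated_convergence (fun x => C * ‖ψ x‖)
      (fun n => (hi (F n)).aestronglyMeasurable) (hψ.norm.const_mul C)
      (fun n => Eventually.of_forall fun x => ?_) (Eventually.of_forall fun x => (hF x).mul_const _)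
    rw [norm_mul]
    exact mul_le_mul_of_nonneg_right (hC n x) (norm_nonneg _)

/-- Integration against the vector measure `g ν`. -/
theorem integral_withDensityᵥ {ν : Measure X} {g : X → E} (hg : Integrable g ν) {f : X → ℝ}
    (hf : Measurable f) {C : ℝ} (hC : ∀ x, ‖f x‖ ≤ C)
    (hv : (ν.withDensityᵥ g).variation univ < ⊤) :
    ∫ᵛ x, f x ∂•(ν.withDensityᵥ g) = ∫ x, f x • g x ∂ν := by
  have hi : ∀ h : SimpleFunc X ℝ, Integrable (fun x => h x • g x) ν := fun h => by
    obtain ⟨C, hC⟩ := h.exists_forall_norm_le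
    exact hg.bdd_smul C h.aestronglyMeasurable (Eventually.of_forall hC)
  refine integral_vectorMeasure_eq_of_indicator hv (fun f => ∫ x, f x • g x ∂ν)
    (fun c s hs => ?_) (fun f g => ?_) (fun F f C hC hF => ?_) hf hC
  · rw [withDensityᵥ_apply hg hs, ← integral_smul, ← integral_indicator hs]
    congr 1
    funext x
    by_cases hx : x ∈ s <;> simp [hx]
  · simp_rw [Pi.add_apply, add_smul]
    exact integral_add (hi f) (hi g)
  · refine tendsto_integral_of_dominated_convergence (fun x => C * ‖g x‖)
      (fun n => (hi (F n)).aestronglyMeasurable) (hg.norm.const_mul C)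
      (fun n => Eventually.of_forall fun x => ?_)
      (Eventually.of_forall fun x => (hF x).smul_const _)
    rw [norm_smul]
    exact mul_le_mul_of_nonneg_right (hC n x) (norm_nonneg _)

end VectorMeasure

/-! ### The gradient measure -/

section Gradient

variable {N : ℕ} {Ω : Set (Eu N)}

theorem IsTest.measurable {φ : Eu N → ℝ} (h : IsTest Ω φ) : Measurable φ :=
  h.1.continuous.measurable

theorem IsTest.exists_bound {φ : Eu N → ℝ} (h : IsTest Ω φ) : ∃ C, ∀ x, ‖φ x‖ ≤ C :=
  h.2.1.exists_bound_of_continuous h.1.continuous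

theorem IsTest.continuous_gradient {φ : Eu N → ℝ} (h : IsTest Ω φ) : Continuous (gradient φ) :=
  (LinearIsometryEquiv.continuous _).comp (h.1.continuous_fderiv (by simp))

theorem IsTest.hasCompactSupport_gradient {φ : Eu N → ℝ} (h : IsTest Ω φ) :
    HasCompactSupport (gradient φ) :=
  (h.2.1.fderiv (𝕜 := ℝ)).comp_left (g := (InnerProductSpace.toDual ℝ (Eu N)).symm) (map_zero _)

theorem IsTest.exists_bound_gradient {φ : Eu N → ℝ} (h : IsTest Ω φ) :
    ∃ C, ∀ x, ‖gradient φ x‖ ≤ C :=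
  h.hasCompactSupport_gradient.exists_bound_of_continuous h.continuous_gradient

theorem IsTest.gradient_eq_zero {φ : Eu N → ℝ} (h : IsTest Ω φ) {x : Eu N} (hx : x ∉ Ω) :
    gradient φ x = 0 := by
  have : x ∉ tsupport φ := fun h' => hx (h.2.2 h')
  rw [gradient, fderiv_of_notMem_tsupport ℝ this, map_zero]

theorem IsTest.mul {φ ψ : Eu N → ℝ} (hφ : IsTest Ω φ) (hψ : ContDiff ℝ ∞ ψ) :
    IsTest Ω fun x => φ x * ψ x :=
  ⟨hφ.1.mul hψ, hφ.2.1.mul_right, (tsupport_mul_subset_left (f := φ) (g := ψ)).trans hφ.2.2⟩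

theorem gradient_mul {φ ψ : Eu N → ℝ} {x : Eu N} (hφ : DifferentiableAt ℝ φ x)
    (hψ : DifferentiableAt ℝ ψ x) :
    gradient (fun x => φ x * ψ x) x = φ x • gradient ψ x + ψ x • gradient φ x := by
  simp only [gradient]
  rw [fderiv_fun_mul hφ hψ, map_add, map_smul, map_smul]

theorem inner_gradient {φ : Eu N → ℝ} (x v : Eu N) :
    inner ℝ (gradient φ x) v = fderiv ℝ φ x v := by
  simp [gradient]

theorem integral_gradient_eq_zero {φ : Eu N → ℝ} (hφ : IsTest Ω φ) :
    ∫ x in Ω, gradient φ x = 0 := by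
  rw [setIntegral_eq_integral_of_forall_compl_eq_zero fun x hx => hφ.gradient_eq_zero hx]
  have hi : Integrable (gradient φ) :=
    hφ.continuous_gradient.integrable_of_hasCompactSupport hφ.hasCompactSupport_gradient
  refine ext_inner_right ℝ fun v => ?_
  rw [inner_zero_left, real_inner_comm, ← integral_inner hi]
  simp_rw [real_inner_comm _ v, inner_gradient]
  have hd := hφ.1.differentiable (by simp)
  have hfi : Integrable fun x => fderiv ℝ φ x v := by
    simp_rw [← inner_gradient]
    exact hi.inner_const v
  have := integral_mul_fderiv_eq_neg_fderiv_mul_of_integrable (μ := volume) (𝕜 := ℝ)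
    (f := fun _ : Eu N => (1 : ℝ)) (g := φ) (v := v) (by simp) (by simpa using hfi)
    (by simpa using hφ.1.continuous.integrable_of_hasCompactSupport hφ.2.1)
    (fun x _ => differentiableAt_const _) (fun x _ => hd x)
  simpa using this

/-- Smooth cutoff functions exhausting an open set `U` recover the mass that a vector measure
gives to `U`. -/
theorem tendsto_integral_cutoff {E : Type*} [NormedAddCommGroup E] [NormedSpace ℝ E]
    [CompleteSpace E] {μ : VectorMeasure (Eu N) E} (hμ : μ.variation univ < ⊤) {U : Set (Eu N)}
    (hU : IsOpen U) {φ : ℕ → Eu N → ℝ} (hφ : ∀ k, IsTest U (φ k))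
    (h01 : ∀ k x, φ k x ∈ Icc (0 : ℝ) 1)
    (hlim : ∀ x, Tendsto (fun k => φ k x) atTop (𝓝 (U.indicator 1 x))) :
    Tendsto (fun k => ∫ᵛ x, φ k x ∂•μ) atTop (𝓝 (μ U)) := by
  have : IsFiniteMeasure μ.variation := ⟨hμ⟩
  have e : ∫ᵛ x, U.indicator (fun _ => (1 : ℝ)) x ∂•μ = μ U := by
    rw [VectorMeasure.integral_indicator_const (1 : ℝ) hU.measurableSet]
    simp
  rw [← e]
  refine VectorMeasure.tendsto_integral_of_dominated_convergence (fun _ => 1)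
    (fun k => (hφ k).1.continuous.aestronglyMeasurable) (integrable_const _)
    (fun k => Eventually.of_forall fun x => ?_) (Eventually.of_forall hlim)
  rw [Real.norm_eq_abs, abs_of_nonneg (h01 k x).1]
  exact (h01 k x).2

theorem apply_inter_of_variation_compl {E : Type*} [NormedAddCommGroup E]
    {μ : VectorMeasure (Eu N) E} (hc : μ.variation Ωᶜ = 0)
    (hΩ : MeasurableSet Ω) {s : Set (Eu N)} (hs : MeasurableSet s) : μ (s ∩ Ω) = μ s := by
  have h0 : μ (s ∩ Ωᶜ) = 0 := by
    have h1 := VectorMeasure.enorm_measure_le_variation μ (s ∩ Ωᶜ)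
    rw [measure_mono_null inter_subset_right hc] at h1
    simpa using h1
  have h2 := VectorMeasure.of_union (v := μ)
    (disjoint_left.2 fun x hx hx' => hx'.2 hx.2 : Disjoint (s ∩ Ω) (s ∩ Ωᶜ))
    (hs.inter hΩ) (hs.inter hΩ.compl)
  rw [inter_union_compl, h0, add_zero] at h2
  exact h2.symm

/-- A finite vector measure on `Ω` is determined by its integrals against test functions. -/
theorem vectorMeasure_ext_of_isTest {E : Type*} [NormedAddCommGroup E] [NormedSpace ℝ E]
    [CompleteSpace E] (hΩ : IsOpen Ω) (hΩb : Bornology.IsBounded Ω) {μ ν : VectorMeasure (Eu N) E}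
    (hμ : μ.variation univ < ⊤) (hν : ν.variation univ < ⊤) (hμc : μ.variation Ωᶜ = 0)
    (hνc : ν.variation Ωᶜ = 0)
    (h : ∀ φ : Eu N → ℝ, IsTest Ω φ → ∫ᵛ x, φ x ∂•μ = ∫ᵛ x, φ x ∂•ν) : μ = ν := by
  have hopen : ∀ U : Set (Eu N), IsOpen U → μ U = ν U := by
    intro U hU
    rw [← apply_inter_of_variation_compl hμc hΩ.measurableSet hU.measurableSet,
      ← apply_inter_of_variation_compl hνc hΩ.measurableSet hU.measurableSet]
    obtain ⟨φ, hφ, h01, hlim⟩ :=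
      exists_isTest_tendsto (hU.inter hΩ) (hΩb.subset inter_subset_right)
    have h1 := tendsto_integral_cutoff hμ (hU.inter hΩ) hφ h01 hlim
    have h2 := tendsto_integral_cutoff hν (hU.inter hΩ) hφ h01 hlim
    refine tendsto_nhds_unique (h1.congr fun k => ?_) h2
    exact h _ ⟨(hφ k).1, (hφ k).2.1, (hφ k).2.2.trans inter_subset_right⟩
  exact VectorMeasure.ext_of_generateFrom {s | IsOpen s} hopen
    (BorelSpace.measurable_eq) isPiSystem_isOpen
    (hopen _ isOpen_univ)

/-- The distributional gradient is unique, so `gradMeasure` does not depend on the choice made in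
its definition. -/
theorem gradMeasure_eq (hΩ : IsOpen Ω) (hΩb : Bornology.IsBounded Ω) {v : Eu N → ℝ}
    {μ : VectorMeasure (Eu N) (Eu N)} (h : IsGradientMeasure Ω v μ) : gradMeasure Ω v = μ := by
  have hex : ∃ μ, IsGradientMeasure Ω v μ := ⟨μ, h⟩
  have h' := hex.choose_spec
  rw [gradMeasure, dif_pos hex]
  refine vectorMeasure_ext_of_isTest hΩ hΩb h'.finite h.finite h'.concentrated h.concentrated
    fun φ hφ => ?_
  rw [← neg_inj, ← h.integral_eq φ hφ, ← h'.integral_eq φ hφ]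

theorem isGradientMeasure_gradMeasure {v : Eu N → ℝ} (h : MemBV Ω v) :
    IsGradientMeasure Ω v (gradMeasure Ω v) := by
  rw [gradMeasure, dif_pos h.2]
  exact h.2.choose_spec

theorem IsGradientMeasure.const_mul {v : Eu N → ℝ} {μ : VectorMeasure (Eu N) (Eu N)}
    (h : IsGradientMeasure Ω v μ) (c : ℝ) : IsGradientMeasure Ω (fun x => c * v x) (c • μ) := by
  refine ⟨?_, ?_, fun φ hφ => ?_⟩
  · rw [VectorMeasure.variation_smul]
    exact ENNReal.mul_lt_top ENNReal.coe_lt_top h.finite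
  · rw [VectorMeasure.variation_smul]
    simp [h.concentrated]
  · rw [VectorMeasure.integral_smul_vectorMeasure, ← smul_neg, ← h.integral_eq φ hφ,
      ← integral_smul]
    simp_rw [mul_smul]

theorem totalVar_const_mul (hΩ : IsOpen Ω) (hΩb : Bornology.IsBounded Ω) {v w : Eu N → ℝ}
    (h : MemBV Ω v) (c : ℝ) (hw : w =ᵐ[volume.restrict Ω] fun x => c * v x) (s : Set (Eu N)) :
    (totalVar Ω w).real s = |c| * (totalVar Ω v).real s := by
  rw [totalVar, gradMeasure_eq hΩ hΩb (((isGradientMeasure_gradMeasure h).const_mul c).congr hw),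
    VectorMeasure.variation_smul, totalVar]
  simp [measureReal_def]

/-- The product rule `D(vψ) = ψ Dv + v ∇ψ dx`. -/
theorem MemBV.mul_isTest (hΩ : MeasurableSet Ω) {v ψ : Eu N → ℝ} (h : MemBV Ω v)
    (hψ : IsTest Ω ψ) : MemBV Ω fun x => v x * ψ x := by
  obtain ⟨hv, μ, hμ⟩ := h
  obtain ⟨C, hC⟩ := hψ.exists_bound
  have hg := hψ.integrableOn_smul_gradient hv
  have hψi := hψ.vm_integrable hμ.finite
  have hle : (μ.withDensity ψ (ContinuousLinearMap.lsmul ℝ ℝ)).variation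
      ≤ μ.variation.withDensity (fun x => ‖ψ x‖ₑ) := by
    have := VectorMeasure.variation_WithDensity_le (μ := μ) (f := ψ)
      (B := ContinuousLinearMap.lsmul ℝ ℝ)
    rwa [VectorMeasure.variation_transpose_lsmul] at this
  have hfin1 : (μ.withDensity ψ (ContinuousLinearMap.lsmul ℝ ℝ)).variation univ < ⊤ := by
    refine (hle univ).trans_lt ?_
    rw [withDensity_apply _ MeasurableSet.univ, Measure.restrict_univ]
    exact hψi.2
  have hfin2 :
      ((volume.restrict Ω).withDensityᵥ fun x => v x • gradient ψ x).variation univ < ⊤ := by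
    rw [Measure.variation_withDensityᵥ hg, withDensity_apply _ MeasurableSet.univ,
      Measure.restrict_univ]
    exact hg.2
  refine ⟨hv.mul_bdd hψ.1.continuous.aestronglyMeasurable (Eventually.of_forall hC),
    μ.withDensity ψ (ContinuousLinearMap.lsmul ℝ ℝ)
      + (volume.restrict Ω).withDensityᵥ (fun x => v x • gradient ψ x), ?_, ?_, fun φ hφ => ?_⟩
  · exact (VectorMeasure.variation_add_le univ).trans_lt (ENNReal.add_lt_top.2 ⟨hfin1, hfin2⟩)
  · refine le_antisymm ((VectorMeasure.variation_add_le _).trans ?_) bot_le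
    have h1 : (μ.withDensity ψ (ContinuousLinearMap.lsmul ℝ ℝ)).variation Ωᶜ = 0 :=
      le_antisymm ((hle _).trans
        (withDensity_absolutelyContinuous μ.variation _ hμ.concentrated).le) bot_le
    have h2 : ((volume.restrict Ω).withDensityᵥ fun x => v x • gradient ψ x).variation Ωᶜ = 0 := by
      rw [Measure.variation_withDensityᵥ hg]
      refine withDensity_absolutelyContinuous _ _ ?_
      rw [Measure.restrict_apply hΩ.compl, compl_inter_self, measure_empty]
    simp [h1, h2]
  · obtain ⟨D, hD⟩ := hφ.exists_bound
    have e1 : ∀ x, (v x * ψ x) • gradient φ x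
        = v x • gradient (fun x => φ x * ψ x) x - φ x • (v x • gradient ψ x) := by
      intro x
      rw [gradient_mul (hφ.1.differentiable (by simp) x) (hψ.1.differentiable (by simp) x),
        smul_add, smul_smul, smul_smul, smul_smul, mul_comm (v x) (φ x)]
      abel
    rw [VectorMeasure.integral_add_vectorMeasure (hφ.vm_integrable hfin1)
      (hφ.vm_integrable hfin2), integral_withDensity_smul hψi hφ.measurable hD hfin1,
      integral_withDensityᵥ hg hφ.measurable hD hfin2]
    simp_rw [e1]
    have hφψ := hφ.mul hψ.1
    have hi : Integrable (fun x => φ x • (v x • gradient ψ x)) (volume.restrict Ω) :=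
      hg.bdd_smul D hφ.1.continuous.aestronglyMeasurable (Eventually.of_forall hD)
    rw [integral_sub (hφψ.integrableOn_smul_gradient hv) hi,
      hμ.integral_eq _ hφψ]
    abel

theorem isGradientMeasure_one : IsGradientMeasure Ω (fun _ => (1 : ℝ)) 0 :=
  ⟨by simp, by simp, fun φ hφ => by simp [integral_gradient_eq_zero hφ]⟩

theorem IsTest.memBV (hΩ : MeasurableSet Ω) (hΩb : Bornology.IsBounded Ω) {φ : Eu N → ℝ}
    (hφ : IsTest Ω φ) : MemBV Ω φ := by
  -- the product rule with the constant function `1 ∈ BV(Ω)`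
  have h1 : MemBV Ω fun _ => (1 : ℝ) :=
    ⟨integrableOn_const hΩb.measure_lt_top.ne, 0, isGradientMeasure_one⟩
  simpa using h1.mul_isTest hΩ hφ

end Gradient

variable {N : ℕ} {Ω : Set (Eu N)}

/-! ### Boundary traces and the `BV` norm -/

theorem isTrace_congr {v w g : Eu N → ℝ} (h : w =ᵐ[volume.restrict Ω] v) (hv : IsTrace Ω v g) :
    IsTrace Ω w g := by
  refine ⟨hv.1, hv.2.mono fun x hx => hx.congr fun r => ?_⟩
  refine average_congr (ae_restrict_of_ae_restrict_of_subset inter_subset_right ?_)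
  filter_upwards [h] with y hy
  rw [hy]

theorem isTrace_const_mul {v g : Eu N → ℝ} (hv : IsTrace Ω v g) (c : ℝ) :
    IsTrace Ω (fun x => c * v x) (fun x => c * g x) := by
  refine ⟨hv.1.const_mul c, hv.2.mono fun x hx => ?_⟩
  have := hx.const_mul |c|
  rw [mul_zero] at this
  refine this.congr fun r => ?_
  simp_rw [← mul_sub, abs_mul, average_eq, smul_eq_mul, integral_const_mul]
  ring

theorem volume_ball_inter_ne_zero (hΩ : IsOpen Ω) {x : Eu N} (hx : x ∈ frontier Ω) {r : ℝ}
    (hr : 0 < r) : volume (Metric.ball x r ∩ Ω) ≠ 0 := by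
  refine ((Metric.isOpen_ball.inter hΩ).measure_pos volume ?_).ne'
  obtain ⟨y, hy, hyx⟩ := Metric.mem_closure_iff.1 hx.1 r hr
  exact ⟨y, by rwa [Metric.mem_ball, dist_comm], hy⟩

/-- The boundary trace of an integrable function is unique. -/
theorem isTrace_unique (hΩ : IsOpen Ω) {v g g' : Eu N → ℝ} (hv : IntegrableOn v Ω)
    (hg : IsTrace Ω v g) (hg' : IsTrace Ω v g') : g =ᵐ[surface Ω] g' := by
  have hfr : ∀ᵐ x ∂(surface Ω), x ∈ frontier Ω := ae_restrict_mem isClosed_frontier.measurableSet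
  filter_upwards [hg.2, hg'.2, hfr] with x hx hx' hxf
  have hsum := hx.add hx'
  rw [add_zero] at hsum
  have : |g x - g' x| ≤ 0 := by
    -- `|g x - g' x| ≤ |v y - g x| + |v y - g' x|`, averaged over `y ∈ B(x, r) ∩ Ω`
    refine ge_of_tendsto hsum ?_
    filter_upwards [self_mem_nhdsWithin] with r hr
    have h0 := volume_ball_inter_ne_zero hΩ hxf hr
    have hfin : volume (Metric.ball x r ∩ Ω) ≠ ⊤ :=
      (Metric.isBounded_ball.subset inter_subset_left).measure_lt_top.ne
    have hpos : 0 < (volume (Metric.ball x r ∩ Ω)).toReal := ENNReal.toReal_pos h0 hfin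
    have hvi : IntegrableOn v (Metric.ball x r ∩ Ω) := hv.mono_set inter_subset_right
    have hi : ∀ c : ℝ, IntegrableOn (fun y => |v y - c|) (Metric.ball x r ∩ Ω) := fun c =>
      (hvi.sub (integrableOn_const hfin)).abs
    have hle : ∫ y in Metric.ball x r ∩ Ω, |g x - g' x|
        ≤ ∫ y in Metric.ball x r ∩ Ω, (|v y - g x| + |v y - g' x|) :=
      integral_mono (integrableOn_const hfin) ((hi _).add (hi _)) fun y => by
        have := abs_sub_le (g x) (v y) (g' x)
        rw [abs_sub_comm (g x) (v y)] at this
        exact this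
    rw [integral_add (hi _) (hi _)] at hle
    rw [← setAverage_const h0 hfin (|g x - g' x|)]
    simp only [setAverage_eq, smul_eq_mul]
    rw [← mul_add]
    exact mul_le_mul_of_nonneg_left hle (inv_nonneg.2 measureReal_nonneg)
  exact sub_eq_zero.1 (abs_nonpos_iff.1 this)

theorem isTrace_trace {v g : Eu N → ℝ} (h : IsTrace Ω v g) : IsTrace Ω v (trace Ω v) := by
  have hex : ∃ g, IsTrace Ω v g := ⟨g, h⟩
  rw [trace, dif_pos hex]
  exact hex.choose_spec

theorem integrable_trace (v : Eu N → ℝ) : Integrable (trace Ω v) (surface Ω) := by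
  by_cases h : ∃ g, IsTrace Ω v g
  · rw [trace, dif_pos h]
    exact h.choose_spec.1
  · rw [trace, dif_neg h]
    exact integrable_zero _ _ _

/-- Homogeneity of the boundary trace. It also holds for functions without a trace, for which
`trace` is zero by convention. -/
theorem trace_const_mul (hΩ : IsOpen Ω) {v w : Eu N → ℝ} (hv : IntegrableOn v Ω) (c : ℝ)
    (hw : w =ᵐ[volume.restrict Ω] fun x => c * v x) :
    trace Ω w =ᵐ[surface Ω] fun x => c * trace Ω v x := by
  have hwi : IntegrableOn w Ω := (hv.const_mul c).congr hw.symm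
  by_cases h : ∃ g, IsTrace Ω v g
  · obtain ⟨g, hg⟩ := h
    have h1 := isTrace_congr hw (isTrace_const_mul (isTrace_trace hg) c)
    exact isTrace_unique hΩ hwi (isTrace_trace h1) h1
  · rcases eq_or_ne c 0 with rfl | hc
    · have h0 : IsTrace Ω (fun _ => (0 : ℝ)) fun _ => 0 :=
        ⟨integrable_zero _ _ _, Eventually.of_forall fun x => by simp⟩
      have h1 : IsTrace Ω w fun _ => 0 := isTrace_congr (hw.trans (by simp)) h0
      simpa using isTrace_unique hΩ hwi (isTrace_trace h1) h1
    · have h' : ¬ ∃ g, IsTrace Ω w g := by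
        rintro ⟨g, hg⟩
        refine h ⟨_, isTrace_congr ?_ (isTrace_const_mul hg c⁻¹)⟩
        filter_upwards [hw] with x hx
        rw [hx, inv_mul_cancel_left₀ hc]
      rw [trace, trace, dif_neg h, dif_neg h']
      exact Eventually.of_forall fun x => (mul_zero c).symm

theorem bvNorm_const_mul (hΩ : IsOpen Ω) (hΩb : Bornology.IsBounded Ω) {v w : Eu N → ℝ}
    (hv : MemBV Ω v) (c : ℝ) (hw : w =ᵐ[volume.restrict Ω] fun x => c * v x) :
    bvNorm Ω w = |c| * bvNorm Ω v := by
  rw [bvNorm, bvNorm, totalVar_const_mul hΩ hΩb hv c hw, mul_add, ← integral_const_mul]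
  congr 1
  refine integral_congr_ae ?_
  filter_upwards [trace_const_mul hΩ hv.1 c hw] with x hx
  rw [hx, abs_mul]

theorem bvNorm_smul (hΩ : IsOpen Ω) (hΩb : Bornology.IsBounded Ω) (c : ℝ) (v : BVL2 Ω) :
    bvNorm Ω ((c • v : BVL2 Ω) : L2 Ω) = |c| * bvNorm Ω (v : L2 Ω) := by
  refine bvNorm_const_mul hΩ hΩb v.2 c ?_
  filter_upwards [Lp.coeFn_smul c (v : L2 Ω)] with x hx
  simpa using hx

/-! ### Elements of `BV(Ω) ∩ L²(Ω)` -/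

theorem pair_eq {ζ : BVL2 Ω →ₗ[ℝ] ℝ} {v : Eu N → ℝ} {w : BVL2 Ω}
    (h : ((w : L2 Ω) : Eu N → ℝ) =ᵐ[volume.restrict Ω] v) : pair ζ v = ζ w := by
  have hex : ∃ w : BVL2 Ω, ((w : L2 Ω) : Eu N → ℝ) =ᵐ[volume.restrict Ω] v := ⟨w, h⟩
  rw [pair, dif_pos hex]
  congr 1
  exact Subtype.ext (Lp.ext (hex.choose_spec.trans h.symm))

theorem pair_coe (ζ : BVL2 Ω →ₗ[ℝ] ℝ) (w : BVL2 Ω) : pair ζ (w : L2 Ω) = ζ w :=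
  pair_eq (ae_eq_refl _)

theorem integral_mul_eq_inner (v w : L2 Ω) : ∫ x in Ω, v x * w x = inner ℝ v w := by
  rw [L2.inner_def]
  refine integral_congr_ae (Eventually.of_forall fun x => ?_)
  simp [mul_comm]

theorem pairSum_coe (θ : BVL2 Ω →ₗ[ℝ] ℝ) (g : L2 Ω) (w : BVL2 Ω) :
    pairSum θ g (w : L2 Ω) = θ w + inner ℝ g (w : L2 Ω) := by
  rw [pairSum, pair_coe, integral_mul_eq_inner]

theorem memBV_congr {v w : Eu N → ℝ} (h : MemBV Ω v) (hw : w =ᵐ[volume.restrict Ω] v) :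
    MemBV Ω w :=
  ⟨h.1.congr hw.symm, h.2.imp fun _ hμ => hμ.congr hw⟩

theorem exists_BVL2 {v : Eu N → ℝ} (h : MemBV Ω v) (h2 : MemLp v 2 (volume.restrict Ω)) :
    ∃ w : BVL2 Ω, ((w : L2 Ω) : Eu N → ℝ) =ᵐ[volume.restrict Ω] v :=
  ⟨⟨h2.toLp v, memBV_congr h h2.coeFn_toLp⟩, h2.coeFn_toLp⟩

theorem exists_BVL2_mul (hΩ : MeasurableSet Ω) (v : BVL2 Ω) {ψ : Eu N → ℝ} (hψ : IsTest Ω ψ) :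
    ∃ w : BVL2 Ω, ((w : L2 Ω) : Eu N → ℝ) =ᵐ[volume.restrict Ω] fun x => (v : L2 Ω) x * ψ x := by
  obtain ⟨C, hC⟩ := hψ.exists_bound
  refine exists_BVL2 (MemBV.mul_isTest hΩ v.2 hψ) ?_
  refine (Lp.memLp (v : L2 Ω)).of_le_mul (c := C)
    ((Lp.aestronglyMeasurable _).mul hψ.1.continuous.aestronglyMeasurable)
    (Eventually.of_forall fun x => ?_)
  rw [norm_mul, mul_comm]
  exact mul_le_mul_of_nonneg_right (hC x) (norm_nonneg _)

theorem exists_BVL2_isTest (hΩ : MeasurableSet Ω) (hΩb : Bornology.IsBounded Ω) {φ : Eu N → ℝ}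
    (hφ : IsTest Ω φ) : ∃ w : BVL2 Ω, ((w : L2 Ω) : Eu N → ℝ) =ᵐ[volume.restrict Ω] φ := by
  obtain ⟨C, hC⟩ := hφ.exists_bound
  have : IsFiniteMeasure (volume.restrict Ω) := ⟨by
    rw [Measure.restrict_apply_univ]; exact hΩb.measure_lt_top⟩
  exact exists_BVL2 (hφ.memBV hΩ hΩb)
    (MemLp.of_bound hφ.1.continuous.aestronglyMeasurable C (Eventually.of_forall hC))

/-! ### Mollification and the Anzellotti inequality -/

section Mollify

variable {E : Type*} [NormedAddCommGroup E] [InnerProductSpace ℝ E] [CompleteSpace E]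

/-- The mollification of `b` at the scale `1 / (n + 1)`. -/
def mollify {E : Type*} [NormedAddCommGroup E] [NormedSpace ℝ E] (n : ℕ) (b : Eu N → E) :
    Eu N → E :=
  convolution ((bump (Eu N) n).normed volume) b (ContinuousLinearMap.lsmul ℝ ℝ) volume

theorem mollify_eq {E : Type*} [NormedAddCommGroup E] [NormedSpace ℝ E] (n : ℕ) (b : Eu N → E)
    (x : Eu N) : mollify n b x = ∫ y, (bump (Eu N) n).normed volume (x - y) • b y :=
  convolution_eq_swap _

theorem integrable_normed_bump (n : ℕ) :
    Integrable ((bump (Eu N) n).normed (volume : Measure (Eu N))) :=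
  (bump (Eu N) n).continuous_normed.integrable_of_hasCompactSupport
    (bump (Eu N) n).hasCompactSupport_normed

/-- Mollifications converge weakly in `L²`: the integral is the mollification at `0` of the
function `y ↦ ∫ ⟨a(x), b(x + y)⟩ dx`, which is continuous because translations act continuously on
`L²`. -/
theorem tendsto_integral_inner_mollify {a b : Eu N → E} (ha : MemLp a 2) (hb : MemLp b 2) :
    Tendsto (fun n => ∫ x, inner ℝ (a x) (mollify n b x)) atTop (𝓝 (∫ x, inner ℝ (a x) (b x))) := by
  have h2 : Fact ((2 : ENNReal) ≠ ⊤) := ⟨by simp⟩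
  set Φ : Eu N → ℝ := fun y => inner ℝ (ha.toLp a) (DomAddAct.mk y +ᵥ hb.toLp b) with hΦ
  have hΦc : Continuous Φ := by
    rw [hΦ]
    fun_prop
  have hΦe : ∀ y, Φ y = ∫ x, inner ℝ (a x) (b (y + x)) := by
    intro y
    simp only [hΦ]
    rw [DomAddAct.mk_vadd_toLp, L2.inner_def]
    refine integral_congr_ae ?_
    filter_upwards [ha.coeFn_toLp, MemLp.coeFn_toLp (hb.comp_measurePreserving
      (measurePreserving_vadd y (volume : Measure (Eu N))))] with x h1 h2
    rw [h1]
    refine congrArg _ (Eq.trans ?_ h2)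
    rfl
  have hlim := ContDiffBump.convolution_tendsto_right_of_continuous (μ := (volume : Measure (Eu N)))
    (tendsto_rOut_bump (Eu N)) hΦc 0
  have h0 : Φ 0 = ∫ x, inner ℝ (a x) (b x) := by simp [hΦe]
  rw [h0] at hlim
  refine hlim.congr fun n => ?_
  set ρ := (bump (Eu N) n).normed (volume : Measure (Eu N)) with hρ
  have hρc : Continuous ρ := (bump (Eu N) n).continuous_normed
  have hρs : HasCompactSupport ρ := (bump (Eu N) n).hasCompactSupport_normed
  have hρ0 : ∀ y, 0 ≤ ρ y := (bump (Eu N) n).nonneg_normed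
  have hbl : LocallyIntegrable b volume := hb.locallyIntegrable (by norm_num)
  -- Fubini's theorem applies, by `|a(x)| |b(x - y)| ≤ |a(x)|² + |b(x - y)|²`
  have hint : Integrable (fun p : Eu N × Eu N => ρ p.2 * inner ℝ (a p.1) (b (p.1 - p.2)))
      (volume.prod volume) := by
    have hd1 : Integrable (fun p : Eu N × Eu N => ‖a p.1‖ ^ 2 * ρ p.2) (volume.prod volume) :=
      (ha.integrable_norm_pow (by norm_num)).mul_prod (integrable_normed_bump n)
    have hd2 : Integrable (fun p : Eu N × Eu N => ρ p.2 * ‖b (p.1 - p.2)‖ ^ 2)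
        (volume.prod volume) :=
      Integrable.convolution_integrand (ContinuousLinearMap.lsmul ℝ ℝ)
        (integrable_normed_bump (N := N) n) (hb.integrable_norm_pow (by norm_num))
    have hm : AEStronglyMeasurable (fun p : Eu N × Eu N => ρ p.2 • b (p.1 - p.2))
        (volume.prod volume) :=
      AEStronglyMeasurable.convolution_integrand (ContinuousLinearMap.lsmul ℝ ℝ)
        hρc.aestronglyMeasurable hb.aestronglyMeasurable
    refine (hd1.add hd2).mono' ?_ (Eventually.of_forall fun p => ?_)
    · have := (ha.aestronglyMeasurable.comp_fst (ν := (volume : Measure (Eu N)))).inner (𝕜 := ℝ) hm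
      simpa only [real_inner_smul_right] using this
    · rw [norm_mul, Real.norm_eq_abs, abs_of_nonneg (hρ0 _)]
      have h1 : ‖(inner ℝ (a p.1) (b (p.1 - p.2)) : ℝ)‖ ≤ ‖a p.1‖ * ‖b (p.1 - p.2)‖ :=
        norm_inner_le_norm _ _
      have h3 : ‖a p.1‖ * ‖b (p.1 - p.2)‖ ≤ ‖a p.1‖ ^ 2 + ‖b (p.1 - p.2)‖ ^ 2 := by
        nlinarith [sq_nonneg (‖a p.1‖ - ‖b (p.1 - p.2)‖), sq_nonneg ‖a p.1‖,
          sq_nonneg ‖b (p.1 - p.2)‖]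
      calc ρ p.2 * ‖(inner ℝ (a p.1) (b (p.1 - p.2)) : ℝ)‖
          ≤ ρ p.2 * (‖a p.1‖ ^ 2 + ‖b (p.1 - p.2)‖ ^ 2) :=
            mul_le_mul_of_nonneg_left (h1.trans h3) (hρ0 _)
        _ = _ := by simp only [Pi.add_apply]; ring
  have e1 : ∀ x, inner ℝ (a x) (mollify n b x) = ∫ y, ρ y * inner ℝ (a x) (b (x - y)) := by
    intro x
    have hex : Integrable fun y => ρ y • b (x - y) :=
      (hρs.convolutionExists_left (ContinuousLinearMap.lsmul ℝ ℝ) hρc hbl) x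
    simp_rw [← real_inner_smul_right]
    rw [integral_inner hex]
    rfl
  simp_rw [e1]
  rw [integral_integral_swap hint]
  refine integral_congr_ae (Eventually.of_forall fun y => ?_)
  simp only [ContinuousLinearMap.lsmul_apply, smul_eq_mul, zero_sub]
  rw [hΦe, ← integral_const_mul]
  simp_rw [neg_add_eq_sub]

omit [CompleteSpace E] in
theorem continuous_mollify {b : Eu N → E} (hb : LocallyIntegrable b) (n : ℕ) :
    Continuous (mollify n b) :=
  (bump (Eu N) n).hasCompactSupport_normed.continuous_convolution_left _
    (bump (Eu N) n).continuous_normed hb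

omit [CompleteSpace E] in
theorem tsupport_mollify_subset {b : Eu N → E} {S : Set (Eu N)} (hS : ∀ x ∉ S, b x = 0) (n : ℕ) :
    tsupport (mollify n b) ⊆ Metric.cthickening (bump (Eu N) n).rOut S := by
  refine closure_minimal (fun x hx => ?_) Metric.isClosed_cthickening
  obtain ⟨y, hy, z, hz, rfl⟩ := support_convolution_subset _ hx
  rw [ContDiffBump.support_normed_eq, mem_ball_zero_iff] at hy
  have hzS : z ∈ S := by
    by_contra h
    exact hz (hS z h)
  exact Metric.mem_cthickening_of_dist_le _ z _ _ hzS (by simpa [dist_eq_norm] using hy.le)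

end Mollify

theorem isTest_mollify {b : Eu N → ℝ} (hb : LocallyIntegrable b) {S : Set (Eu N)}
    (hSc : IsCompact S) (hS : ∀ x ∉ S, b x = 0) {n : ℕ}
    (hSn : Metric.cthickening (bump (Eu N) n).rOut S ⊆ Ω) : IsTest Ω (mollify n b) := by
  have hsub := tsupport_mollify_subset hS n
  refine ⟨?_, ?_, hsub.trans hSn⟩
  · exact (bump (Eu N) n).hasCompactSupport_normed.contDiff_convolution_left _
      (bump (Eu N) n).contDiff_normed hb
  · exact hSc.cthickening.of_isClosed_subset (isClosed_tsupport _) hsub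

theorem gradient_mollify {b : Eu N → ℝ} (hb : LocallyIntegrable b) (n : ℕ) (x : Eu N) :
    gradient (mollify n b) x
      = ∫ y, b y • gradient ((bump (Eu N) n).normed volume) (x - y) := by
  set ρ := (bump (Eu N) n).normed (volume : Measure (Eu N)) with hρ
  have hρt : IsTest univ ρ :=
    ⟨(bump (Eu N) n).contDiff_normed, (bump (Eu N) n).hasCompactSupport_normed, subset_univ _⟩
  have hd := hρt.2.1.hasFDerivAt_convolution_left (μ := volume) (ContinuousLinearMap.lsmul ℝ ℝ)
    (hρt.1.of_le (by simp)) hb x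
  have hex : Integrable fun y => b y • gradient ρ (x - y) := by
    have h1 := hρt.hasCompactSupport_gradient.convolutionExists_right
      (ContinuousLinearMap.lsmul ℝ ℝ) hb hρt.continuous_gradient x
    exact h1
  have hex' : Integrable fun y => (ContinuousLinearMap.precompL (Eu N)
      (ContinuousLinearMap.lsmul ℝ ℝ : ℝ →L[ℝ] ℝ →L[ℝ] ℝ)) (fderiv ℝ ρ (x - y)) (b y) :=
    ((hρt.2.1.fderiv (𝕜 := ℝ)).convolutionExists_left
      (ContinuousLinearMap.precompL (Eu N) (ContinuousLinearMap.lsmul ℝ ℝ : ℝ →L[ℝ] ℝ →L[ℝ] ℝ))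
      (hρt.1.continuous_fderiv (by simp)) hb x).integrable_swap
  refine ext_inner_right ℝ fun v => ?_
  rw [inner_gradient, real_inner_comm, ← integral_inner hex]
  have e : fderiv ℝ (mollify n b) x = _ := hd.fderiv
  rw [e, convolution_eq_swap, ContinuousLinearMap.integral_apply hex' v]
  refine integral_congr_ae (Eventually.of_forall fun y => ?_)
  simp only [ContinuousLinearMap.precompL_apply, ContinuousLinearMap.lsmul_apply, smul_eq_mul]
  rw [real_inner_smul_right, real_inner_comm, inner_gradient, mul_comm]

/-- `∇(ρ * vψ) = ρ * (v ∇ψ) + ρ * (ψ Dv)` for the mollifier `ρ` and `v ∈ BV(Ω)`: test the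
definition of `Dv` with `y ↦ ψ(y) ρ(x - y)`. -/
theorem gradient_mollify_mul {v ψ : Eu N → ℝ} {μ : VectorMeasure (Eu N) (Eu N)}
    (hΩ : MeasurableSet Ω)
    (hv : IntegrableOn v Ω) (hμ : IsGradientMeasure Ω v μ) (hψ : IsTest Ω ψ) (n : ℕ) (x : Eu N) :
    gradient (mollify n (Ω.indicator fun y => v y * ψ y)) x
      = mollify n (Ω.indicator fun y => v y • gradient ψ y) x
        + ∫ᵛ y, ψ y * (bump (Eu N) n).normed volume (x - y) ∂•μ := by
  set ρ := (bump (Eu N) n).normed (volume : Measure (Eu N)) with hρ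
  have hρt : IsTest univ ρ :=
    ⟨(bump (Eu N) n).contDiff_normed, (bump (Eu N) n).hasCompactSupport_normed, subset_univ _⟩
  obtain ⟨C, hC⟩ := hψ.exists_bound
  obtain ⟨D, hD⟩ := hρt.exists_bound_gradient
  have hbi : IntegrableOn (fun y => v y * ψ y) Ω :=
    hv.mul_bdd hψ.1.continuous.aestronglyMeasurable (Eventually.of_forall hC)
  have hbl : LocallyIntegrable (Ω.indicator fun y => v y * ψ y) volume :=
    ((integrable_indicator_iff hΩ).2 hbi).locallyIntegrable
  have hφ : IsTest Ω fun y => ψ y * ρ (x - y) :=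
    hψ.mul (hρt.1.comp (contDiff_const.sub contDiff_id))
  have hgρ : ∀ y, gradient (fun y => ρ (x - y)) y = - gradient ρ (x - y) := by
    intro y
    have h1 : HasFDerivAt (fun y => ρ (x - y)) ((fderiv ℝ ρ (x - y)).comp
        (-ContinuousLinearMap.id ℝ (Eu N))) y :=
      ((hρt.1.differentiable (by simp)) (x - y)).hasFDerivAt.comp y ((hasFDerivAt_id y).const_sub x)
    simp only [gradient]
    rw [h1.fderiv, ContinuousLinearMap.comp_neg, ContinuousLinearMap.comp_id, map_neg]
  have hφg : ∀ y, gradient (fun y => ψ y * ρ (x - y)) y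
      = ρ (x - y) • gradient ψ y - ψ y • gradient ρ (x - y) := by
    intro y
    have hd : DifferentiableAt ℝ (fun y => ρ (x - y)) y :=
      (hρt.1.differentiable (by simp) (x - y)).comp y (differentiableAt_id.const_sub x)
    rw [gradient_mul (hψ.1.differentiable (by simp) y) hd, hgρ, smul_neg]
    abel
  have i1 : IntegrableOn (fun y => v y • gradient (fun y => ψ y * ρ (x - y)) y) Ω :=
    hφ.integrableOn_smul_gradient hv
  have i2 : IntegrableOn (fun y => (v y * ψ y) • gradient ρ (x - y)) Ω :=
    hbi.smul_bdd D ((hρt.continuous_gradient.comp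
      (continuous_const.sub continuous_id)).aestronglyMeasurable)
      (Eventually.of_forall fun y => hD _)
  have key := hμ.integral_eq _ hφ
  rw [gradient_mollify hbl, mollify_eq]
  have e1 : ∫ y, Ω.indicator (fun y => v y * ψ y) y • gradient ρ (x - y)
      = ∫ y in Ω, (v y * ψ y) • gradient ρ (x - y) := by
    rw [← integral_indicator hΩ]
    refine integral_congr_ae (Eventually.of_forall fun y => ?_)
    by_cases hy : y ∈ Ω <;> simp [hy]
  have e2 : ∫ y, ρ (x - y) • Ω.indicator (fun y => v y • gradient ψ y) y
      = (∫ y in Ω, v y • gradient (fun y => ψ y * ρ (x - y)) y)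
        + ∫ y in Ω, (v y * ψ y) • gradient ρ (x - y) := by
    rw [← integral_add i1 i2, ← integral_indicator hΩ]
    refine integral_congr_ae (Eventually.of_forall fun y => ?_)
    by_cases hy : y ∈ Ω
    · simp only [indicator_of_mem hy, hφg]
      rw [smul_sub, smul_smul, smul_smul, smul_smul, mul_comm (v y) (ρ _)]
      abel
    · simp [hy]
  rw [e1, e2, key]
  abel

/-- **Anzellotti's inequality** for a bounded field `Z` with divergence `h ∈ L²(Ω)`: the pairing
`(Z, Dv)`, tested with `|ψ| ≤ 1`, is bounded by `‖Z‖_∞ |Dv|(Ω)`. Write `ρ` for a mollifier. The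
test function `ρ * vψ` turns the mollified pairing into `-∫ Z · (ρ * ψ Dv)`, and the convolution
`ρ * ψ Dv` has `L¹`-norm at most `|Dv|(Ω)`. -/
theorem abs_pairing_le {v ψ h : Eu N → ℝ} {Z : Eu N → Eu N} {M : ℝ}
    {μ : VectorMeasure (Eu N) (Eu N)} (hΩ : IsOpen Ω) (hΩb : Bornology.IsBounded Ω)
    (hv : IntegrableOn v Ω) (hv2 : MemLp v 2 (volume.restrict Ω)) (hμ : IsGradientMeasure Ω v μ)
    (hψ : IsTest Ω ψ) (hψ1 : ∀ x, |ψ x| ≤ 1)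
    (hZ : AEStronglyMeasurable Z (volume.restrict Ω)) (hM : 0 ≤ M)
    (hZM : ∀ᵐ x ∂(volume.restrict Ω), ‖Z x‖ ≤ M)
    (hh : MemLp h 2 (volume.restrict Ω))
    (hdiv : ∀ φ : Eu N → ℝ, IsTest Ω φ →
      ∫ x in Ω, inner ℝ (Z x) (gradient φ x) = - ∫ x in Ω, h x * φ x) :
    |(∫ x in Ω, h x * (v x * ψ x)) + ∫ x in Ω, v x * inner ℝ (Z x) (gradient ψ x)|
      ≤ M * μ.variation.real univ := by
  have hfin : IsFiniteMeasure μ.variation := ⟨hμ.finite⟩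
  have hfinΩ : IsFiniteMeasure (volume.restrict Ω) := ⟨by
    rw [Measure.restrict_apply_univ]; exact hΩb.measure_lt_top⟩
  have hΩm := hΩ.measurableSet
  obtain ⟨D, hD⟩ := hψ.exists_bound_gradient
  set b : Eu N → ℝ := Ω.indicator fun y => v y * ψ y with hb
  set K : Eu N → Eu N := Ω.indicator fun y => v y • gradient ψ y with hK
  have hb2 : MemLp b 2 := by
    rw [hb, memLp_indicator_iff_restrict hΩm]
    refine hv2.of_le_mul (c := 1) (hv2.aestronglyMeasurable.mul
      hψ.1.continuous.aestronglyMeasurable) (Eventually.of_forall fun x => ?_)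
    rw [norm_mul, mul_comm]
    exact mul_le_mul_of_nonneg_right (hψ1 x) (norm_nonneg _)
  have hK2 : MemLp K 2 := by
    rw [hK, memLp_indicator_iff_restrict hΩm]
    refine hv2.of_le_mul (c := D) (hv2.aestronglyMeasurable.smul
      hψ.continuous_gradient.aestronglyMeasurable) (Eventually.of_forall fun x => ?_)
    rw [norm_smul, mul_comm]
    exact mul_le_mul_of_nonneg_right (hD x) (norm_nonneg _)
  have hh2 : MemLp (Ω.indicator h) 2 := (memLp_indicator_iff_restrict hΩm).2 hh
  have hZ2 : MemLp (Ω.indicator Z) 2 :=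
    (memLp_indicator_iff_restrict hΩm).2 (MemLp.of_bound hZ M hZM)
  have hbl : LocallyIntegrable b volume := hb2.locallyIntegrable (by norm_num)
  have hKl : LocallyIntegrable K volume := hK2.locallyIntegrable (by norm_num)
  have hS : ∀ x ∉ tsupport ψ, b x = 0 := fun x hx => by
    by_cases h : x ∈ Ω <;> simp [hb, h, image_eq_zero_of_notMem_tsupport hx]
  have hSK : ∀ x ∉ tsupport ψ, K x = 0 := fun x hx => by
    by_cases h : x ∈ Ω <;> simp [hK, h, gradient, fderiv_of_notMem_tsupport ℝ hx]
  -- the bound is proved for the mollifications, which converge weakly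
  have l1 := tendsto_integral_inner_mollify hh2 hb2
  have l2 := tendsto_integral_inner_mollify hZ2 hK2
  have e1 : ∫ x, inner ℝ (Ω.indicator h x) (b x) = ∫ x in Ω, h x * (v x * ψ x) := by
    rw [← integral_indicator hΩm]
    refine integral_congr_ae (Eventually.of_forall fun x => ?_)
    by_cases hx : x ∈ Ω <;> simp [hb, hx, mul_comm]
  have e2 : ∫ x, inner ℝ (Ω.indicator Z x) (K x)
      = ∫ x in Ω, v x * inner ℝ (Z x) (gradient ψ x) := by
    rw [← integral_indicator hΩm]
    refine integral_congr_ae (Eventually.of_forall fun x => ?_)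
    by_cases hx : x ∈ Ω <;> simp [hK, hx, real_inner_smul_right]
  rw [← e1, ← e2]
  refine le_of_tendsto (l1.add l2).abs ?_
  obtain ⟨δ, hδ, hδΩ⟩ := hψ.2.1.isCompact.exists_cthickening_subset_open hΩ hψ.2.2
  filter_upwards [(tendsto_rOut_bump (Eu N)).eventually_le_const hδ] with n hn
  set ρ := (bump (Eu N) n).normed (volume : Measure (Eu N)) with hρ
  have hρ0 : ∀ y, 0 ≤ ρ y := (bump (Eu N) n).nonneg_normed
  have hG : IsTest Ω (mollify n b) :=
    isTest_mollify hbl hψ.2.1 hS ((Metric.cthickening_mono hn _).trans hδΩ)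
  have hKc : Continuous (mollify n K) := continuous_mollify hKl n
  have hKs : HasCompactSupport (mollify n K) :=
    hψ.2.1.isCompact.cthickening.of_isClosed_subset (isClosed_tsupport _)
      (tsupport_mollify_subset hSK n)
  obtain ⟨C₁, hC₁⟩ := hG.exists_bound_gradient
  obtain ⟨C₂, hC₂⟩ := hKs.exists_bound_of_continuous hKc
  have hi : ∀ (Y : Eu N → Eu N) (C : ℝ), Continuous Y → (∀ x, ‖Y x‖ ≤ C) →
      Integrable (fun x => (inner ℝ (Z x) (Y x) : ℝ)) (volume.restrict Ω) := by
    intro Y C hY hC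
    refine Integrable.of_bound (hZ.inner hY.aestronglyMeasurable) (M * C) ?_
    filter_upwards [hZM] with x hx
    exact (norm_inner_le_norm _ _).trans (mul_le_mul hx (hC x) (norm_nonneg _) hM)
  set A : Eu N → Eu N := fun x => ∫ᵛ y, ψ y * ρ (x - y) ∂•μ with hA
  have hAe : ∀ x, gradient (mollify n b) x = mollify n K x + A x := fun x =>
    gradient_mollify_mul hΩm hv hμ hψ n x
  have f1 : ∫ x, inner ℝ (Ω.indicator h x) (mollify n b x) = ∫ x in Ω, h x * mollify n b x := by
    rw [← integral_indicator hΩm]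
    refine integral_congr_ae (Eventually.of_forall fun x => ?_)
    by_cases hx : x ∈ Ω <;> simp [hx, mul_comm]
  have f2 : ∫ x, inner ℝ (Ω.indicator Z x) (mollify n K x)
      = ∫ x in Ω, inner ℝ (Z x) (mollify n K x) := by
    rw [← integral_indicator hΩm]
    refine integral_congr_ae (Eventually.of_forall fun x => ?_)
    by_cases hx : x ∈ Ω <;> simp [hx]
  have f3 : (∫ x in Ω, h x * mollify n b x) + ∫ x in Ω, inner ℝ (Z x) (mollify n K x)
      = - ∫ x in Ω, inner ℝ (Z x) (A x) := by
    have g1 := hdiv _ hG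
    have g2 : ∫ x in Ω, inner ℝ (Z x) (A x)
        = (∫ x in Ω, inner ℝ (Z x) (gradient (mollify n b) x))
          - ∫ x in Ω, inner ℝ (Z x) (mollify n K x) := by
      rw [← integral_sub (hi _ _ hG.continuous_gradient hC₁) (hi _ _ hKc hC₂)]
      refine integral_congr_ae (Eventually.of_forall fun x => ?_)
      simp only
      rw [hAe, inner_add_right, add_sub_cancel_left]
    rw [g2, g1]
    ring
  rw [f1, f2, f3, abs_neg]
  -- Tonelli's theorem: the total mass of `ρ * |Dv|` is the mass of `|Dv|`
  have hprod : Integrable (fun p : Eu N × Eu N => (1 : ℝ) * ρ (p.1 - p.2))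
      (volume.prod μ.variation) :=
    Integrable.convolution_integrand (ContinuousLinearMap.lsmul ℝ ℝ)
      (integrable_const (1 : ℝ)) (integrable_normed_bump (N := N) n)
  simp_rw [one_mul] at hprod
  have hAb : ∀ x, ‖A x‖ ≤ ∫ y, ρ (x - y) ∂μ.variation := by
    intro x
    obtain ⟨R, hR⟩ := (bump (Eu N) n).hasCompactSupport_normed.exists_bound_of_continuous
      ((bump (Eu N) n).continuous_normed (μ := volume))
    have hρi : Integrable (fun y => ρ (x - y)) μ.variation :=
      Integrable.of_bound ((bump (Eu N) n).continuous_normed.comp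
        (continuous_const.sub continuous_id)).aestronglyMeasurable R
        (Eventually.of_forall fun y => hR _)
    refine (VectorMeasure.norm_integral_le_integral_norm).trans ?_
    refine (mul_le_of_le_one_left (integral_nonneg fun _ => norm_nonneg _)
      ContinuousLinearMap.opNorm_lsmul_le).trans ?_
    refine integral_mono_of_nonneg (Eventually.of_forall fun _ => norm_nonneg _) hρi
      (Eventually.of_forall fun y => ?_)
    simp only [norm_mul, Real.norm_eq_abs, abs_of_nonneg (hρ0 _)]
    exact mul_le_of_le_one_left (hρ0 _) (hψ1 y)
  have hBi : Integrable (fun x => ∫ y, ρ (x - y) ∂μ.variation) := hprod.integral_prod_left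
  have hB0 : ∀ x, 0 ≤ ∫ y, ρ (x - y) ∂μ.variation := fun x => integral_nonneg fun y => hρ0 _
  have hBe : ∫ x, ∫ y, ρ (x - y) ∂μ.variation = μ.variation.real univ := by
    rw [integral_integral_swap hprod]
    have : ∀ y, ∫ x, ρ (x - y) = 1 := fun y => by
      rw [integral_sub_right_eq_self ρ y]
      exact (bump (Eu N) n).integral_normed
    simp [this]
  calc |∫ x in Ω, inner ℝ (Z x) (A x)|
      ≤ ∫ x in Ω, M * ∫ y, ρ (x - y) ∂μ.variation := by
        rw [← Real.norm_eq_abs]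
        refine norm_integral_le_of_norm_le (hBi.integrableOn.const_mul M) ?_
        filter_upwards [hZM] with x hx
        exact (norm_inner_le_norm _ _).trans (mul_le_mul hx (hAb x) (norm_nonneg _) hM)
    _ = M * ∫ x in Ω, ∫ y, ρ (x - y) ∂μ.variation := integral_const_mul _ _
    _ ≤ M * ∫ x, ∫ y, ρ (x - y) ∂μ.variation :=
        mul_le_mul_of_nonneg_left (setIntegral_le_integral hBi (Eventually.of_forall hB0)) hM
    _ = _ := by rw [hBe]

/-! ### Test functions of separated variables -/

theorem IsTest.hasDerivAt {U : Set ℝ} {η : ℝ → ℝ} (h : IsTest U η) (t : ℝ) :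
    HasDerivAt η (deriv η t) t :=
  ((h.1.differentiable (by simp)) t).hasDerivAt

theorem IsTest.continuous_deriv {U : Set ℝ} {η : ℝ → ℝ} (h : IsTest U η) : Continuous (deriv η) :=
  h.1.continuous_deriv (by simp)

theorem IsTest.exists_bound_deriv {U : Set ℝ} {η : ℝ → ℝ} (h : IsTest U η) :
    ∃ C, ∀ t, ‖deriv η t‖ ≤ C :=
  h.2.1.deriv.exists_bound_of_continuous h.continuous_deriv

theorem IsTest.exists_bound_real {U : Set ℝ} {η : ℝ → ℝ} (h : IsTest U η) : ∃ C, ∀ t, ‖η t‖ ≤ C :=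
  h.2.1.exists_bound_of_continuous h.1.continuous

theorem IsTest.integrable_deriv {U : Set ℝ} {η : ℝ → ℝ} (h : IsTest U η) :
    Integrable (deriv η) :=
  h.continuous_deriv.integrable_of_hasCompactSupport h.2.1.deriv

theorem IsTest.integral_deriv_Ioo {T : ℝ} {η : ℝ → ℝ} (h : IsTest (Ioo 0 T) η) {t : ℝ}
    (ht : 0 ≤ t) : ∫ s in Ioo 0 t, deriv η s = η t := by
  rw [← integral_Ioc_eq_integral_Ioo, ← intervalIntegral.integral_of_le ht,
    intervalIntegral.integral_eq_sub_of_hasDerivAt (fun s _ => h.hasDerivAt s)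
      (h.continuous_deriv.intervalIntegrable _ _), h.eq_zero (x := 0) (by simp), sub_zero]

/-- For a scalar test function `η` of time and `w ∈ BV(Ω) ∩ L²(Ω)`, the function `η(t) w` is an
admissible test function for the time derivative. -/
theorem isTimeTest_smul (hΩ : IsOpen Ω) (hΩb : Bornology.IsBounded Ω) {T : ℝ} (hT : 0 < T)
    {η : ℝ → ℝ} (hη : IsTest (Ioo 0 T) η) (w : BVL2 Ω) :
    IsTimeTest Ω T (fun t => η t • w) (fun t => deriv η t • w) := by
  obtain ⟨C, hC⟩ := hη.exists_bound_real
  obtain ⟨D, hD⟩ := hη.exists_bound_deriv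
  have hm : AEStronglyMeasurable (fun t => ((η t • w : BVL2 Ω) : L2 Ω))
      (volume.restrict (Ioo 0 T)) :=
    (hη.1.continuous.smul continuous_const).aestronglyMeasurable
  have hηi : Integrable η := hη.1.continuous.integrable_of_hasCompactSupport hη.2.1
  have hℓ : ∀ (ℓ : BVL2 Ω →ₗ[ℝ] ℝ) (S : Set ℝ),
      IntegrableOn (fun s => ℓ (deriv η s • w)) S ∧
        ∫ s in S, ℓ (deriv η s • w) = (∫ s in S, deriv η s) * ℓ w := by
    intro ℓ S
    simp_rw [map_smul, smul_eq_mul]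
    exact ⟨hη.integrable_deriv.integrableOn.mul_const _, integral_mul_const _ _⟩
  refine ⟨⟨hm, Eventually.of_forall fun t => (η t • w).2, ?_⟩, ?_, ?_, ⟨?_, ?_, ?_⟩, ?_, ?_⟩
  · simp_rw [bvNorm_smul hΩ hΩb]
    exact (hηi.abs.mul_const _).integrableOn
  · refine MemLp.of_bound hm (C * ‖(w : L2 Ω)‖) (Eventually.of_forall fun t => ?_)
    rw [Submodule.coe_smul, norm_smul]
    exact mul_le_mul_of_nonneg_right (hC t) (norm_nonneg _)
  · rcases (tsupport η).eq_empty_or_nonempty with h | h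
    · refine ⟨T / 2, T / 2, by linarith, by linarith, fun t _ _ => ?_⟩
      have h0 : η t = 0 := image_eq_zero_of_notMem_tsupport (by rw [h]; exact notMem_empty t)
      simp only [h0, zero_smul]
    · obtain ⟨a, ha⟩ := hη.2.1.isCompact.exists_isLeast h
      obtain ⟨b, hb⟩ := hη.2.1.isCompact.exists_isGreatest h
      refine ⟨a, b, (hη.2.2 ha.1).1, (hη.2.2 hb.1).2, fun t _ ht => ?_⟩
      have h0 : η t = 0 := image_eq_zero_of_notMem_tsupport fun h' => ht ⟨ha.2 h', hb.2 h'⟩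
      simp only [h0, zero_smul]
  · intro ℓ _
    exact (hℓ ℓ (Ioo 0 T)).1.aestronglyMeasurable.aemeasurable
  · simp_rw [bvNorm_smul hΩ hΩb]
    exact (hη.integrable_deriv.abs.mul_const _).integrableOn
  · exact (hη.integrable_deriv.smul_const (w : L2 Ω)).integrableOn
  · intro S _ _
    refine ⟨(∫ s in S, deriv η s) • w, fun ℓ _ => ⟨(hℓ ℓ S).1, ?_⟩⟩
    rw [(hℓ ℓ S).2, map_smul, smul_eq_mul]
  · intro t ht ℓ _
    refine ⟨(hℓ ℓ _).1, ?_⟩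
    rw [(hℓ ℓ _).2, hη.integral_deriv_Ioo ht.1.le, map_smul, smul_eq_mul]

/-- `⟪ξ, w⟫` is the distributional derivative of `∫ u w` for fixed `w ∈ BV(Ω) ∩ L²(Ω)`. -/
theorem IsTimeDerivative.integral_smul (hΩ : IsOpen Ω) (hΩb : Bornology.IsBounded Ω) {T : ℝ}
    (hT : 0 < T) {u : ℝ → L2 Ω} {θ : ℝ → BVL2 Ω →ₗ[ℝ] ℝ} {g : ℝ → L2 Ω}
    (h : IsTimeDerivative Ω T u θ g) {η : ℝ → ℝ} (hη : IsTest (Ioo 0 T) η) (w : BVL2 Ω) :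
    ∫ t in Ioo 0 T, η t * (θ t w + inner ℝ (g t) (w : L2 Ω))
      = - ∫ t in Ioo 0 T, deriv η t * inner ℝ (u t) (w : L2 Ω) := by
  have := h.integral_eq _ _ (isTimeTest_smul hΩ hΩb hT hη w)
  simp_rw [pairSum_coe, integral_mul_eq_inner, map_smul, Submodule.coe_smul, real_inner_smul_right,
    smul_eq_mul, ← mul_add] at this
  exact this

/-! ### The divergence as an `L²` functional after averaging in time -/

section Solution

variable {T : ℝ} {f : ℝ → L2 Ω} {u₀ : L2 Ω} {u : ℝ → L2 Ω} {z : ℝ → Eu N → Eu N}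
  {ζ : ℝ → BVL2 Ω →ₗ[ℝ] ℝ} {γ : ℝ → Eu N → ℝ} {θ : ℝ → BVL2 Ω →ₗ[ℝ] ℝ} {g : ℝ → L2 Ω}

theorem MemDual.integrable (h : MemDual Ω T ζ) (w : BVL2 Ω) :
    IntegrableOn (fun t => ζ t w) (Ioo 0 T) := by
  obtain ⟨C, hC⟩ := h.2
  refine Integrable.of_bound (h.1 w).aestronglyMeasurable (C * bvl2Norm w) ?_
  filter_upwards [hC] with t ht using ht w

theorem IsSolutionWith.integrable_inner (h : IsSolutionWith Ω T f u₀ u z ζ γ θ g) (w : L2 Ω) :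
    IntegrableOn (fun t => (inner ℝ (u t) w : ℝ)) (Ioo 0 T) :=
  ((h.continuousOn.inner continuousOn_const).integrableOn_Icc).mono_set Ioo_subset_Icc_self

/-- The equation `u' = div z + f`, tested with `η(t) w` for fixed `w ∈ BV(Ω) ∩ L²(Ω)`. -/
theorem IsSolutionWith.integral_smul (hΩ : IsOpen Ω) (hΩb : Bornology.IsBounded Ω) (hT : 0 < T)
    (h : IsSolutionWith Ω T f u₀ u z ζ γ θ g) {η : ℝ → ℝ} (hη : IsTest (Ioo 0 T) η) (w : BVL2 Ω) :
    ∫ t in Ioo 0 T, η t * (ζ t w + inner ℝ (f t) (w : L2 Ω))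
      = - ∫ t in Ioo 0 T, deriv η t * inner ℝ (u t) (w : L2 Ω) := by
  rw [← h.timeDerivative.integral_smul hΩ hΩb hT hη w]
  refine integral_congr_ae ?_
  filter_upwards [h.equation] with t ht
  have := ht w
  rw [pairSum_coe, pairSum_coe] at this
  rw [this]

/-- After averaging in time against a test function, the divergence of the field is represented by
an element of `L²(Ω)`. -/
theorem IsSolutionWith.exists_L2_representative (hΩ : IsOpen Ω) (hΩb : Bornology.IsBounded Ω)
    (hT : 0 < T) (hf : IntegrableOn f (Ioo 0 T)) (h : IsSolutionWith Ω T f u₀ u z ζ γ θ g)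
    {η : ℝ → ℝ} (hη : IsTest (Ioo 0 T) η) :
    ∃ k : L2 Ω, ∀ w : BVL2 Ω, ∫ t in Ioo 0 T, η t * ζ t w = inner ℝ k (w : L2 Ω) := by
  obtain ⟨C, hC⟩ := hη.exists_bound_real
  obtain ⟨D, hD⟩ := hη.exists_bound_deriv
  have hui : IntegrableOn u (Ioo 0 T) :=
    h.continuousOn.integrableOn_Icc.mono_set Ioo_subset_Icc_self
  have i1 : Integrable (fun t => deriv η t • u t) (volume.restrict (Ioo 0 T)) :=
    hui.bdd_smul D hη.continuous_deriv.aestronglyMeasurable (Eventually.of_forall hD)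
  have i2 : Integrable (fun t => η t • f t) (volume.restrict (Ioo 0 T)) :=
    hf.bdd_smul C hη.1.continuous.aestronglyMeasurable (Eventually.of_forall hC)
  refine ⟨-(∫ t in Ioo 0 T, deriv η t • u t) - ∫ t in Ioo 0 T, η t • f t, fun w => ?_⟩
  have e1 : inner ℝ (∫ t in Ioo 0 T, deriv η t • u t) (w : L2 Ω)
      = ∫ t in Ioo 0 T, deriv η t * inner ℝ (u t) (w : L2 Ω) := by
    rw [real_inner_comm, ← integral_inner i1]
    simp_rw [real_inner_comm _ (w : L2 Ω), real_inner_smul_left]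
  have e2 : inner ℝ (∫ t in Ioo 0 T, η t • f t) (w : L2 Ω)
      = ∫ t in Ioo 0 T, η t * inner ℝ (f t) (w : L2 Ω) := by
    rw [real_inner_comm, ← integral_inner i2]
    simp_rw [real_inner_comm _ (w : L2 Ω), real_inner_smul_left]
  have i3 : Integrable (fun t => η t * ζ t w) (volume.restrict (Ioo 0 T)) :=
    (h.div_memDual.integrable w).bdd_mul hη.1.continuous.aestronglyMeasurable
      (Eventually.of_forall hC)
  have i4 : Integrable (fun t => η t * inner ℝ (f t) (w : L2 Ω)) (volume.restrict (Ioo 0 T)) :=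
    (hf.inner_const (w : L2 Ω)).bdd_mul hη.1.continuous.aestronglyMeasurable
      (Eventually.of_forall hC)
  have key := h.integral_smul hΩ hΩb hT hη w
  simp_rw [mul_add] at key
  rw [integral_add i3 i4] at key
  rw [inner_sub_left, inner_neg_left, e1, e2]
  linarith

/-- `(t, x) ↦ z(t, x) · Y(x)` is integrable for `Y ∈ L¹(Ω)`. -/
theorem IsSolutionWith.integrable_inner_field (h : IsSolutionWith Ω T f u₀ u z ζ γ θ g)
    {Y : Eu N → Eu N} (hY : IntegrableOn Y Ω) :
    Integrable (fun p : ℝ × Eu N => (inner ℝ (z p.1 p.2) (Y p.2) : ℝ))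
      ((volume.restrict (Ioo 0 T)).prod (volume.restrict Ω)) := by
  have hd : Integrable (fun p : ℝ × Eu N => (1 : ℝ) * ‖Y p.2‖)
      ((volume.restrict (Ioo 0 T)).prod (volume.restrict Ω)) :=
    (integrable_const (1 : ℝ)).mul_prod hY.norm
  refine hd.mono' (h.z_measurable.inner hY.aestronglyMeasurable.comp_snd) ?_
  filter_upwards [h.z_bound] with p hp
  exact (norm_inner_le_norm _ _).trans (mul_le_mul_of_nonneg_right hp (norm_nonneg _))

/-- The time average `∫ η(t) z(t, ·) dt` of the field of a solution. -/
def timeAverage (T : ℝ) (η : ℝ → ℝ) (z : ℝ → Eu N → Eu N) (x : Eu N) : Eu N :=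
  ∫ t in Ioo 0 T, η t • z t x

theorem IsSolutionWith.integrable_smul_field (hΩb : Bornology.IsBounded Ω)
    (h : IsSolutionWith Ω T f u₀ u z ζ γ θ g) {η : ℝ → ℝ} (hη : IsTest (Ioo 0 T) η) :
    Integrable (fun p : ℝ × Eu N => η p.1 • z p.1 p.2)
      ((volume.restrict (Ioo 0 T)).prod (volume.restrict Ω)) := by
  have hfinΩ : IsFiniteMeasure (volume.restrict Ω) := ⟨by
    rw [Measure.restrict_apply_univ]; exact hΩb.measure_lt_top⟩
  obtain ⟨C, hC⟩ := hη.exists_bound_real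
  refine Integrable.of_bound ((hη.1.continuous.comp continuous_fst).aestronglyMeasurable.smul
    h.z_measurable) (C * 1) ?_
  filter_upwards [h.z_bound] with p hp
  rw [norm_smul]
  exact mul_le_mul (hC _) hp (norm_nonneg _) ((norm_nonneg _).trans (hC 0))

theorem IsSolutionWith.aestronglyMeasurable_timeAverage (hΩb : Bornology.IsBounded Ω)
    (h : IsSolutionWith Ω T f u₀ u z ζ γ θ g) {η : ℝ → ℝ} (hη : IsTest (Ioo 0 T) η) :
    AEStronglyMeasurable (timeAverage T η z) (volume.restrict Ω) :=
  (h.integrable_smul_field hΩb hη).integral_prod_right.aestronglyMeasurable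

theorem IsSolutionWith.norm_timeAverage_le (h : IsSolutionWith Ω T f u₀ u z ζ γ θ g) {η : ℝ → ℝ}
    (hη : IsTest (Ioo 0 T) η) (hη0 : ∀ t, 0 ≤ η t) :
    ∀ᵐ x ∂(volume.restrict Ω), ‖timeAverage T η z x‖ ≤ ∫ t in Ioo 0 T, η t := by
  have hsw := (Measure.measurePreserving_swap (μ := volume.restrict Ω)
    (ν := volume.restrict (Ioo 0 T))).quasiMeasurePreserving.ae h.z_bound
  filter_upwards [Measure.ae_ae_of_ae_prod hsw] with x hx
  refine norm_integral_le_of_norm_le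
    (hη.1.continuous.integrable_of_hasCompactSupport hη.2.1).integrableOn ?_
  filter_upwards [hx] with t ht
  rw [norm_smul, Real.norm_eq_abs, abs_of_nonneg (hη0 t)]
  exact mul_le_of_le_one_right (hη0 t) ht

theorem IsSolutionWith.integral_inner_timeAverage (hΩb : Bornology.IsBounded Ω)
    (h : IsSolutionWith Ω T f u₀ u z ζ γ θ g) {η : ℝ → ℝ} (hη : IsTest (Ioo 0 T) η)
    {Y : Eu N → Eu N} (hY : IntegrableOn Y Ω) :
    ∫ x in Ω, inner ℝ (timeAverage T η z x) (Y x)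
      = ∫ t in Ioo 0 T, η t * ∫ x in Ω, inner ℝ (z t x) (Y x) := by
  obtain ⟨C, hC⟩ := hη.exists_bound_real
  have hi : Integrable (fun p : ℝ × Eu N => η p.1 * inner ℝ (z p.1 p.2) (Y p.2))
      ((volume.restrict (Ioo 0 T)).prod (volume.restrict Ω)) :=
    (h.integrable_inner_field hY).bdd_mul
      (hη.1.continuous.comp continuous_fst).aestronglyMeasurable
      (Eventually.of_forall fun p => hC p.1)
  simp_rw [← integral_const_mul]
  rw [integral_integral_swap hi]
  refine integral_congr_ae ?_
  filter_upwards [(h.integrable_smul_field hΩb hη).prod_left_ae] with x hx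
  rw [timeAverage, real_inner_comm, ← integral_inner hx]
  simp_rw [real_inner_smul_right, real_inner_comm]

theorem variation_real_univ {v : Eu N → ℝ} {μ : VectorMeasure (Eu N) (Eu N)}
    (hΩ : MeasurableSet Ω) (hμ : IsGradientMeasure Ω v μ) :
    μ.variation.real univ = μ.variation.real Ω := by
  have : IsFiniteMeasure μ.variation := ⟨hμ.finite⟩
  rw [← measureReal_add_measureReal_compl hΩ, measureReal_def μ.variation Ωᶜ, hμ.concentrated]
  simp

/-- For a fixed `w`, the pairing `(z(t), Dw)`, tested with `|ψ| ≤ 1`, is bounded by `|Dw|(Ω)` for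
almost every `t`. Anzellotti's inequality is not available for `z(t)` itself, whose divergence need
not be a function, but it is for the averages of `z` in time. -/
theorem IsSolutionWith.pairing_le (hΩ : IsOpen Ω) (hΩb : Bornology.IsBounded Ω) (hT : 0 < T)
    (hf : IntegrableOn f (Ioo 0 T)) (h : IsSolutionWith Ω T f u₀ u z ζ γ θ g) (w : BVL2 Ω)
    {ψ : Eu N → ℝ} (hψ : IsTest Ω ψ) (hψ1 : ∀ x, |ψ x| ≤ 1) :
    ∀ᵐ t ∂(volume.restrict (Ioo 0 T)),
      pairing (z t) (ζ t) w ψ ≤ (totalVar Ω (w : L2 Ω)).real Ω := by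
  obtain ⟨wψ, hwψ⟩ := exists_BVL2_mul hΩ.measurableSet w hψ
  have hμ := isGradientMeasure_gradMeasure w.2
  have hY : IntegrableOn (fun x => (w : L2 Ω) x • gradient ψ x) Ω :=
    hψ.integrableOn_smul_gradient w.2.1
  have hp : ∀ t, pairing (z t) (ζ t) w ψ
      = - ζ t wψ - ∫ x in Ω, inner ℝ (z t x) ((w : L2 Ω) x • gradient ψ x) := by
    intro t
    rw [pairing, pair_eq hwψ]
    simp_rw [real_inner_smul_right]
  have hi1 : IntegrableOn (fun t => - ζ t wψ) (Ioo 0 T) := (h.div_memDual.integrable wψ).neg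
  have hi2 : IntegrableOn (fun t => ∫ x in Ω, inner ℝ (z t x) ((w : L2 Ω) x • gradient ψ x))
      (Ioo 0 T) := (h.integrable_inner_field hY).integral_prod_left
  have hpi : IntegrableOn (fun t => pairing (z t) (ζ t) w ψ) (Ioo 0 T) := by
    simp_rw [hp]
    exact hi1.sub hi2
  have hnn := ae_nonneg_of_forall_isTest
    (G := fun t => (totalVar Ω (w : L2 Ω)).real Ω - pairing (z t) (ζ t) w ψ)
    ((integrable_const _).sub hpi) ?_
  · filter_upwards [hnn] with t ht
    linarith
  intro η hη hη0
  obtain ⟨C, hC⟩ := hη.exists_bound_real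
  have hηi : IntegrableOn η (Ioo 0 T) :=
    (hη.1.continuous.integrable_of_hasCompactSupport hη.2.1).integrableOn
  obtain ⟨k, hk⟩ := h.exists_L2_representative hΩ hΩb hT hf hη
  -- the averaged field has divergence `k ∈ L²(Ω)`
  have hdiv : ∀ φ : Eu N → ℝ, IsTest Ω φ →
      ∫ x in Ω, inner ℝ (timeAverage T η z x) (gradient φ x) = - ∫ x in Ω, k x * φ x := by
    intro φ hφ
    obtain ⟨wφ, hwφ⟩ := exists_BVL2_isTest hΩ.measurableSet hΩb hφ
    have hgi : IntegrableOn (gradient φ) Ω :=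
      (hφ.continuous_gradient.integrable_of_hasCompactSupport
        hφ.hasCompactSupport_gradient).integrableOn
    have e1 : ∫ x in Ω, k x * φ x = ∫ t in Ioo 0 T, η t * ζ t wφ := by
      rw [hk wφ, ← integral_mul_eq_inner]
      refine integral_congr_ae ?_
      filter_upwards [hwφ] with x hx
      rw [hx]
    rw [h.integral_inner_timeAverage hΩb hη hgi, e1, ← integral_neg]
    refine integral_congr_ae ?_
    filter_upwards [h.div_extends] with t ht
    have := ht φ hφ
    rw [pair_eq hwφ] at this
    rw [this]
    ring
  have key := abs_pairing_le hΩ hΩb w.2.1 (Lp.memLp (w : L2 Ω)) hμ hψ hψ1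
    (h.aestronglyMeasurable_timeAverage hΩb hη) (integral_nonneg hη0)
    (h.norm_timeAverage_le hη hη0) (Lp.memLp k) hdiv
  have e2 : ∫ x in Ω, k x * ((w : L2 Ω) x * ψ x) = ∫ t in Ioo 0 T, η t * ζ t wψ := by
    rw [hk wψ, ← integral_mul_eq_inner]
    refine integral_congr_ae ?_
    filter_upwards [hwψ] with x hx
    rw [hx]
  have e3 : ∫ x in Ω, (w : L2 Ω) x * inner ℝ (timeAverage T η z x) (gradient ψ x)
      = ∫ t in Ioo 0 T, η t * ∫ x in Ω, inner ℝ (z t x) ((w : L2 Ω) x • gradient ψ x) := by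
    rw [← h.integral_inner_timeAverage hΩb hη hY]
    simp_rw [real_inner_smul_right]
  have e4 : ∫ t in Ioo 0 T, η t * pairing (z t) (ζ t) w ψ
      = -((∫ t in Ioo 0 T, η t * ζ t wψ)
        + ∫ t in Ioo 0 T, η t * ∫ x in Ω, inner ℝ (z t x) ((w : L2 Ω) x • gradient ψ x)) := by
    rw [← integral_add ((h.div_memDual.integrable wψ).bdd_mul
      hη.1.continuous.aestronglyMeasurable (Eventually.of_forall hC))
      (hi2.bdd_mul hη.1.continuous.aestronglyMeasurable (Eventually.of_forall hC)), ← integral_neg]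
    refine integral_congr_ae (Eventually.of_forall fun t => ?_)
    simp only [hp]
    ring
  rw [e2, e3, variation_real_univ hΩ.measurableSet hμ] at key
  have key2 := (abs_le.1 key).1
  simp_rw [mul_sub]
  rw [integral_sub (hηi.mul_const _)
    (hpi.bdd_mul hη.1.continuous.aestronglyMeasurable (Eventually.of_forall hC)),
    integral_mul_const, e4]
  rw [totalVar]
  linarith

end Solution

/-! ### The evolution variational inequality -/

section Solution

variable {T : ℝ} {f : ℝ → L2 Ω} {u₀ : L2 Ω} {u : ℝ → L2 Ω} {z : ℝ → Eu N → Eu N}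
  {ζ : ℝ → BVL2 Ω →ₗ[ℝ] ℝ} {γ : ℝ → Eu N → ℝ} {θ : ℝ → BVL2 Ω →ₗ[ℝ] ℝ} {g : ℝ → L2 Ω}

/-- For a fixed `w`, the functional `-div z(t)` is bounded at `w` by the `BV`-norm for almost every
`t`; the exceptional set depends on `w`. -/
theorem IsSolutionWith.neg_bvNorm_le (hΩ : IsOpen Ω) (hΩb : Bornology.IsBounded Ω) (hT : 0 < T)
    (hf : IntegrableOn f (Ioo 0 T)) (h : IsSolutionWith Ω T f u₀ u z ζ γ θ g) (w : BVL2 Ω) :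
    ∀ᵐ t ∂(volume.restrict (Ioo 0 T)), - bvNorm Ω (w : L2 Ω) ≤ ζ t w := by
  obtain ⟨φ, hφ, h01, hlim⟩ := exists_isTest_tendsto hΩ hΩb
  have hle := ae_all_iff.2 fun k => h.pairing_le hΩ hΩb hT hf w (hφ k) fun x =>
    abs_le.2 ⟨by linarith [(h01 k x).1], (h01 k x).2⟩
  filter_upwards [hle, h.green, h.normalTrace_bound] with t ht hgreen hγ
  obtain ⟨μ, hμ, hG⟩ := hgreen w
  have h1 : μ Ω ≤ (totalVar Ω (w : L2 Ω)).real Ω :=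
    le_of_tendsto' (tendsto_integral_cutoff hμ.1 hΩ hφ h01 hlim) fun k =>
      (hμ.2.2 _ (hφ k)).symm.le.trans (ht k)
  have h2 : ‖∫ x, trace Ω (w : L2 Ω) x * γ t x ∂(surface Ω)‖
      ≤ ∫ x, |trace Ω (w : L2 Ω) x| ∂(surface Ω) := by
    refine norm_integral_le_of_norm_le (integrable_trace _).abs ?_
    filter_upwards [hγ] with x hx
    rw [norm_mul]
    exact mul_le_of_le_one_right (norm_nonneg _) hx
  have h3 := (abs_le.1 h2).1
  rw [bvNorm]
  linarith

/-- Along the solution itself, `-div z(t)` attains the `BV`-norm. -/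
theorem IsSolutionWith.apply_self_eq (hΩ : IsOpen Ω) (hΩb : Bornology.IsBounded Ω)
    (h : IsSolutionWith Ω T f u₀ u z ζ γ θ g) :
    ∀ᵐ t ∂(volume.restrict (Ioo 0 T)), ∀ v : BVL2 Ω, (v : L2 Ω) = u t →
      ζ t v = - bvNorm Ω (u t) := by
  obtain ⟨φ, hφ, h01, hlim⟩ := exists_isTest_tendsto hΩ hΩb
  filter_upwards [h.green, h.pairing_eq, h.boundary] with t hgreen hp hb v hv
  obtain ⟨μ, hμ, hG⟩ := hgreen v
  have hfin : IsFiniteMeasure (totalVar Ω (u t)) :=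
    ⟨(isGradientMeasure_gradMeasure (hv ▸ v.2)).finite⟩
  have h1 : Tendsto (fun k => ∫ x, φ k x ∂(totalVar Ω (u t))) atTop
      (𝓝 ((totalVar Ω (u t)).real Ω)) := by
    rw [← integral_indicator_one hΩ.measurableSet]
    refine tendsto_integral_of_dominated_convergence (fun _ => 1)
      (fun k => (hφ k).1.continuous.aestronglyMeasurable) (integrable_const _)
      (fun k => Eventually.of_forall fun x => ?_) (Eventually.of_forall hlim)
    rw [Real.norm_eq_abs]
    exact abs_le.2 ⟨by linarith [(h01 k x).1], (h01 k x).2⟩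
  -- the total mass of the pairing measure, by testing with the cutoffs
  have h2 : μ Ω = (totalVar Ω (u t)).real Ω := by
    refine tendsto_nhds_unique (tendsto_integral_cutoff hμ.1 hΩ hφ h01 hlim) ?_
    refine h1.congr fun k => ?_
    rw [← hp v hv _ (hφ k), hμ.2.2 _ (hφ k)]
  -- `s y = -|s|` for `y ∈ sign(-s)`
  have h3 : ∫ x, trace Ω (v : L2 Ω) x * γ t x ∂(surface Ω)
      = - ∫ x, |trace Ω (u t) x| ∂(surface Ω) := by
    rw [← integral_neg, hv]
    refine integral_congr_ae ?_
    filter_upwards [hb] with x hx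
    rcases lt_trichotomy (trace Ω (u t) x) 0 with h0 | h0 | h0
    · rw [hx.2.1 (by linarith), abs_of_neg h0]
      ring
    · simp [h0]
    · rw [hx.2.2 (by linarith), abs_of_pos h0]
      ring
  rw [bvNorm]
  linarith

/-- The evolution variational inequality: for every `w ∈ BV(Ω) ∩ L²(Ω)`,
`½ (‖u - w‖²)' ≤ ‖w‖_{BV} - ‖u‖_{BV} + ⟨f, u - w⟩` in integrated form. -/
theorem IsSolutionWith.evi (hΩ : IsOpen Ω) (hΩb : Bornology.IsBounded Ω) (hT : 0 < T)
    (hf : IntegrableOn f (Ioo 0 T)) (h : IsSolutionWith Ω T f u₀ u z ζ γ θ g) (w : BVL2 Ω)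
    {a b : ℝ} (ha : 0 ≤ a) (hab : a ≤ b) (hb : b ≤ T) :
    1 / 2 * ‖u b - w‖ ^ 2 - 1 / 2 * ‖u a - w‖ ^ 2
      ≤ ∫ t in a..b, (bvNorm Ω (w : L2 Ω) - bvNorm Ω (u t) + inner ℝ (f t) (u t - w)) := by
  -- a continuous extension of `u` from `[0, T]` to the line
  set U : ℝ → L2 Ω := IccExtend hT.le ((Icc 0 T).domRestrict u) with hU
  have hUc : Continuous U := (continuousOn_iff_continuous_domRestrict.1 h.continuousOn).Icc_extend'
  have hUu : ∀ t ∈ Icc 0 T, U t = u t := fun t ht => IccExtend_of_mem _ _ ht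
  obtain ⟨M, hM⟩ := isCompact_Icc.exists_bound_of_continuousOn h.continuousOn
  have hum : AEStronglyMeasurable u (volume.restrict (Ioo 0 T)) := h.memL1BV.1
  have hfu : IntegrableOn (fun t => (inner ℝ (f t) (u t) : ℝ)) (Ioo 0 T) := by
    refine (hf.norm.mul_const M).mono' (hf.aestronglyMeasurable.inner hum) ?_
    filter_upwards [ae_restrict_mem measurableSet_Ioo] with t ht
    exact (norm_inner_le_norm _ _).trans
      (mul_le_mul_of_nonneg_left (hM t (Ioo_subset_Icc_self ht)) (norm_nonneg _))
  have hfw : IntegrableOn (fun t => (inner ℝ (f t) (w : L2 Ω) : ℝ)) (Ioo 0 T) :=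
    hf.inner_const _
  have hbv := h.memL1BV.2.2
  have hGi : IntegrableOn (fun t => bvNorm Ω (w : L2 Ω) - bvNorm Ω (u t)
      + inner ℝ (f t) (u t - w)) (Ioo 0 T) := by
    simp_rw [inner_sub_right]
    exact ((integrable_const _).sub hbv).add (hfu.sub hfw)
  have key := sub_le_integral_of_forall_isTest (F := fun t => 1 / 2 * ‖U t - w‖ ^ 2)
    (by fun_prop) hGi ?_ a b ha hab hb
  · simpa only [hUu a ⟨ha, hab.trans hb⟩, hUu b ⟨ha.trans hab, hb⟩] using key
  intro η hη hη0
  obtain ⟨C, hC⟩ := hη.exists_bound_real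
  obtain ⟨D, hD⟩ := hη.exists_bound_deriv
  have hηm := hη.1.continuous.aestronglyMeasurable (μ := volume.restrict (Ioo 0 T))
  have hη'm := hη.continuous_deriv.aestronglyMeasurable (μ := volume.restrict (Ioo 0 T))
  have hmul : ∀ {q : ℝ → ℝ}, IntegrableOn q (Ioo 0 T) →
      IntegrableOn (fun t => η t * q t) (Ioo 0 T) := fun hq =>
    hq.bdd_mul hηm (Eventually.of_forall hC)
  have hmul' : ∀ {q : ℝ → ℝ}, IntegrableOn q (Ioo 0 T) →
      IntegrableOn (fun t => deriv η t * q t) (Ioo 0 T) := fun hq =>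
    hq.bdd_mul hη'm (Eventually.of_forall hD)
  have hsq : IntegrableOn (fun t => 1 / 2 * ∫ x in Ω, (u t x) ^ 2) (Ioo 0 T) := by
    have : ContinuousOn (fun t => 1 / 2 * ‖u t‖ ^ 2) (Icc 0 T) :=
      continuousOn_const.mul (h.continuousOn.norm.pow 2)
    refine (this.integrableOn_Icc.mono_set Ioo_subset_Icc_self).congr
      (Eventually.of_forall fun t => ?_)
    simp_rw [pow_two, integral_mul_eq_inner, real_inner_self_eq_norm_mul_norm]
  -- expand `½ ‖u - w‖²`; the constant `½ ‖w‖²` drops out because `∫ η' = 0`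
  have e1 : ∫ t in Ioo 0 T, deriv η t * (1 / 2 * ‖U t - w‖ ^ 2)
      = (∫ t in Ioo 0 T, deriv η t * (1 / 2 * ∫ x in Ω, (u t x) ^ 2))
        - ∫ t in Ioo 0 T, deriv η t * inner ℝ (u t) (w : L2 Ω) := by
    have e0 : ∫ t in Ioo 0 T, deriv η t * (1 / 2 * ‖(w : L2 Ω)‖ ^ 2) = 0 := by
      rw [integral_mul_const, hη.integral_deriv_Ioo hT.le, hη.eq_zero (x := T) (by simp), zero_mul]
    rw [← add_zero (_ - _), ← integral_sub (hmul' hsq) (hmul' (h.integrable_inner w))]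
    refine Eq.trans ?_ (congrArg _ e0)
    have i0 : IntegrableOn (fun t => deriv η t * (1 / 2 * ∫ x in Ω, (u t x) ^ 2)
        - deriv η t * inner ℝ (u t) (w : L2 Ω)) (Ioo 0 T) :=
      (hmul' hsq).sub (hmul' (h.integrable_inner w))
    rw [← integral_add i0 (hη.integrable_deriv.integrableOn.mul_const _)]
    refine setIntegral_congr_fun measurableSet_Ioo fun t ht => ?_
    simp_rw [hUu t (Ioo_subset_Icc_self ht), pow_two (u t _), integral_mul_eq_inner,
      real_inner_self_eq_norm_mul_norm, norm_sub_sq_real]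
    ring
  have e2 := h.energy.2 η hη
  have e3 := h.integral_smul hΩ hΩb hT hη w
  have e4 : ∫ t in Ioo 0 T, η t * pairSum (θ t) (g t) (u t)
      = ∫ t in Ioo 0 T, η t * (- bvNorm Ω (u t) + inner ℝ (f t) (u t)) := by
    refine integral_congr_ae ?_
    filter_upwards [h.equation, h.memL1BV.2.1, h.apply_self_eq hΩ hΩb] with t he ht hs
    have := he ⟨u t, ht⟩
    rw [this, pairSum_coe, hs ⟨u t, ht⟩ rfl]
  have hζw := h.div_memDual.integrable w
  have i1 : IntegrableOn (fun t => - bvNorm Ω (u t) + inner ℝ (f t) (u t)) (Ioo 0 T) :=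
    hbv.neg.add hfu
  have i2 : IntegrableOn (fun t => ζ t w + inner ℝ (f t) (w : L2 Ω)) (Ioo 0 T) := hζw.add hfw
  rw [e1, neg_sub, sub_eq_add_neg, ← e2, e4, ← neg_neg (∫ t in Ioo 0 T, deriv η t * inner ℝ _ _),
    ← e3, add_comm, ← sub_eq_add_neg, ← integral_sub (hmul i1) (hmul i2)]
  refine integral_mono_ae ((hmul i1).sub (hmul i2)) (hmul hGi) ?_
  filter_upwards [h.neg_bvNorm_le hΩ hΩb hT hf w] with t ht
  rw [← mul_sub, inner_sub_right]
  exact mul_le_mul_of_nonneg_left (by linarith) (hη0 t)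

end Solution

end TVFlow

end

theorem mainTheorem2 {N : ℕ} (hN : 2 ≤ N) (Ω : Set (TVFlow.Eu N)) (hΩ : IsOpen Ω)
    (hΩb : Bornology.IsBounded Ω) (hΩL : TVFlow.HasLipschitzBoundary Ω) (T : ℝ) (hT : 0 < T)
    (f : ℝ → TVFlow.L2 Ω) (hf : IntegrableOn f (Ioo 0 T)) (u₀ : TVFlow.L2 Ω)
    (u₁ u₂ : ℝ → TVFlow.L2 Ω) (h₁ : TVFlow.IsSolution Ω T f u₀ u₁)
    (h₂ : TVFlow.IsSolution Ω T f u₀ u₂) :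
    ∀ t ∈ Icc 0 T, u₁ t = u₂ t := by
  obtain ⟨z₁, ζ₁, γ₁, θ₁, g₁, s₁⟩ := h₁
  obtain ⟨z₂, ζ₂, γ₂, θ₂, g₂, s₂⟩ := h₂
  refine TVFlow.eq_of_evi hT s₁.continuousOn s₂.continuousOn
    ((integrableOn_Ioc_iff_integrableOn_Ioo (by simp)).2 hf)
    ((integrableOn_Ioc_iff_integrableOn_Ioo (by simp)).2 s₁.memL1BV.2.2)
    ((integrableOn_Ioc_iff_integrableOn_Ioo (by simp)).2 s₂.memL1BV.2.2)
    (s₁.initial.trans s₂.initial.symm) ?_ ?_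
  · rw [← Measure.restrict_congr_set Ioo_ae_eq_Ioc]
    -- at almost every time `s` the second solution is in `BV(Ω)` and may be inserted for `w`
    filter_upwards [s₂.memL1BV.2.1] with s hs a b ha hab hb
    exact s₁.evi hΩ hΩb hT hf ⟨u₂ s, hs⟩ ha hab hb
  · rw [← Measure.restrict_congr_set Ioo_ae_eq_Ioc]
    filter_upwards [s₁.memL1BV.2.1] with s hs a b ha hab hb
    exact s₂.evi hΩ hΩb hT hf ⟨u₁ s, hs⟩ ha hab hb
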